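/- Theorem (Stability of the SDP: Real Case). Let $L_1,L_2\ge 1$, $N=L_1+L_2$, and let $\mathbf x_1\in\mathbb R^{L_1}$ have nonzero first coefficient and $\mathbf x_2\in\mathbb R^{L_2}$ have nonzero first and last coefficients. Put $\mathbf x=[\mathbf x_1,\mathbf x_2]\in\mathbb R^N$ and $\tilde{\mathbf x}_i=\mathbf x_i/\|\mathbf x\|$. Notation. For $\mathbf u\in\mathbb C^L$, indices run over $0,\dots,L-1$; $\mathbf u^-$ is the time reversal $(u_{L-1-k})_k$ and $\mathbf u^0=(\mathbf u,0)$. For $X\in\mathbb C^{N\times N}$ with blocks $X_{i,j}\in\mathbb C^{L_i\times L_j}$, the measurement map $\mathcal A:\mathbb C^{N\times N}\to\mathbb C^{4N-4}$ is $\mathcal A(X)=(\operatorname{tr}(A_{i,j,k}X))$, over $i,j\in\{1,2\}$ and $0\le k\le L_i+L_j-2$, where the only nonzero block of $A_{i,j,k}$ is block $(j,i)$, which is the $L_j\times L_i$ zero-one matrix with ones exactly where row minus column equals $L_j-1-k$. Thus $\mathcal A(\mathbf x\mathbf x^*)$ lists the correlations $\mathbf x_i*\overline{\mathbf x_j^-}$.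 For $\mathbf a\in\mathbb R^{L_2+1}$, $\mathbf b\in\mathbb R^{L_1+1}$, the Sylvester matrix $S_{\mathbf a,\mathbf b}\in\mathbb R^{N\times N}$ has as its first $L_1$ columns the successive down shifts (by $0,\dots,L_1-1$) of $\mathbf a$ padded with zeros, and as its last $L_2$ columns the successive down shifts (by $0,\dots,L_2-1$) of $\mathbf b$ padded with zeros. Let $$W=S_{\tilde{\mathbf x}_2^0,-\tilde{\mathbf x}_1^0}^*S_{\tilde{\mathbf x}_2^0,-\tilde{\mathbf x}_1^0},\qquad W_-=S_{(\tilde{\mathbf x}_2^{-})^0,-\tilde{\mathbf x}_1^0}^*S_{(\tilde{\mathbf x}_2^{-})^0,-\tilde{\mathbf x}_1^0},$$ and let $\lambda_2$ denote the second smallest eigenvalue, counted with multiplicity. For $\mathbf u\in\mathbb R^L$ let $p_{\mathbf u}(z)=\sum_{k=0}^{L-1}u_kz^{L-1-k}$, whose roots are the zeros of the $z$-transform of $\mathbf u$ when $u_0\neq0$. Then: (a) $\lambda_2(W)>0$ if and only if $p_{\mathbf x_1}$ and $p_{\mathbf x_2}$ are coprime, and $\lambda_2(W_-)>0$ if and only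 if $p_{\mathbf x_1}$ and $p_{\mathbf x_2^-}$ are coprime. (b) Suppose that $\lambda_2(W)>0$ and $\lambda_2(W_-)>0$. For every $\mathbf n\in\mathbb C^{4N-4}$, with $\mathbf b=\mathcal A(\mathbf x\mathbf x^*)+\mathbf n$, every solution $\hat X$ of the denoised SDP $$\min_{X\succeq0}\|\mathcal A(X)-\mathbf b\|,$$ where $X$ ranges either over all complex Hermitian or over all real symmetric positive semidefinite $N\times N$ matrices, satisfies $$\|\hat X-\mathbf x\mathbf x^*\|_F\le C\,\|\mathbf n\|,\qquad C=2N\left(\frac{23N^2}{\lambda_2(W)\sqrt{\lambda_2(W_-)}}+\frac1{\lambda_2(W)}+\frac{4\sqrt2}{\sqrt{\lambda_2(W_-)}}\right).$$ -/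

import Mathlib

open scoped Matrix ComplexOrder

-- On matrices, `‖·‖` is the Frobenius (= Schatten-2) norm.
attribute [local instance] Matrix.frobeniusNormedAddCommGroup

namespace BlindDeconv

/-! ### Signals -/

/-- The stacked signal `x = [x₁, x₂]` of dimension `N = L₁ + L₂`, with its Euclidean norm. -/
noncomputable def stack {L₁ L₂ : ℕ} (x₁ : Fin L₁ → ℝ) (x₂ : Fin L₂ → ℝ) :
    EuclideanSpace ℝ (Fin L₁ ⊕ Fin L₂) :=
  WithLp.toLp 2 (Sum.elim x₁ x₂)

/-- The lifted signal `x x*`, as a complex matrix. -/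
noncomputable def liftedSignal {L₁ L₂ : ℕ} (x₁ : Fin L₁ → ℝ) (x₂ : Fin L₂ → ℝ) :
    Matrix (Fin L₁ ⊕ Fin L₂) (Fin L₁ ⊕ Fin L₂) ℂ :=
  Matrix.of fun p q => ((stack x₁ x₂ p : ℝ) : ℂ) * star ((stack x₁ x₂ q : ℝ) : ℂ)

/-- The time reversal `x⁻`, with `(x⁻)_k = x_{L-1-k}`. -/
def reversal {L : ℕ} (x : Fin L → ℝ) : Fin L → ℝ := fun k => x k.rev

/-- `z^(L-1) X(z)` for the z-transform `X(z) = ∑ₖ xₖ z^(-k)`, a polynomial in `z`.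
If `x₀ ≠ 0` it has degree exactly `L - 1`, and its complex roots are the zeros of the
z-transform. For real polynomials `IsCoprime` means that there is no common complex root. -/
noncomputable def zPoly {L : ℕ} (x : Fin L → ℝ) : Polynomial ℝ :=
  ∑ k : Fin L, Polynomial.C (x k) * Polynomial.X ^ (L - 1 - (k : ℕ))

/-! ### The measurement map -/

/-- The `m × n` shift matrix `T^(k)`, with ones exactly where `row - column = m - 1 - k`, so that
`v* T^(k) u = ∑_l u_l conj(v_{m-1-(k-l)})` is entry `k` of the correlation of `u` with `v`. -/
def shiftMatrix (m n : ℕ) (k : ℕ) : Matrix (Fin m) (Fin n) ℂ :=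
  Matrix.of fun r c => if (r : ℕ) + k + 1 = (c : ℕ) + m then 1 else 0

/-- Indices of the `4N - 4` measurements: the pairs `(1,1), (1,2), (2,1), (2,2)` in this order,
each followed by its lag index `k`. -/
abbrev MeasIdx (L₁ L₂ : ℕ) : Type :=
  (Fin (L₁ + L₁ - 1) ⊕ Fin (L₁ + L₂ - 1)) ⊕ (Fin (L₂ + L₁ - 1) ⊕ Fin (L₂ + L₂ - 1))

/-- The measurement matrices `A_{i,j,k}`: the shift matrix `T^(k)_{j,i}` in block `(j,i)`. -/
def measMatrix (L₁ L₂ : ℕ) :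
    MeasIdx L₁ L₂ → Matrix (Fin L₁ ⊕ Fin L₂) (Fin L₁ ⊕ Fin L₂) ℂ
  | Sum.inl (Sum.inl k) => Matrix.fromBlocks (shiftMatrix L₁ L₁ k) 0 0 0
  | Sum.inl (Sum.inr k) => Matrix.fromBlocks 0 0 (shiftMatrix L₂ L₁ k) 0
  | Sum.inr (Sum.inl k) => Matrix.fromBlocks 0 (shiftMatrix L₁ L₂ k) 0 0
  | Sum.inr (Sum.inr k) => Matrix.fromBlocks 0 0 0 (shiftMatrix L₂ L₂ k)

/-- The measurement map `𝒜(X)_{i,j,k} = tr(A_{i,j,k} X)`; thus `𝒜(x x*)` lists the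
autocorrelations and cross-correlations of `x₁` and `x₂`. -/
noncomputable def measMap {L₁ L₂ : ℕ} (X : Matrix (Fin L₁ ⊕ Fin L₂) (Fin L₁ ⊕ Fin L₂) ℂ) :
    EuclideanSpace ℂ (MeasIdx L₁ L₂) :=
  WithLp.toLp 2 fun s => (measMatrix L₁ L₂ s * X).trace

/-- The cone of complex Hermitian positive semidefinite matrices. -/
def psdCone (L₁ L₂ : ℕ) : Set (Matrix (Fin L₁ ⊕ Fin L₂) (Fin L₁ ⊕ Fin L₂) ℂ) :=
  {X | X.PosSemidef}

/-- The cone of real symmetric positive semidefinite matrices. -/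
def realPsdCone (L₁ L₂ : ℕ) : Set (Matrix (Fin L₁ ⊕ Fin L₂) (Fin L₁ ⊕ Fin L₂) ℂ) :=
  {X | X.PosSemidef ∧ ∀ p q, (X p q).im = 0}

/-- `Xhat` solves `min_{X ∈ K} ‖𝒜(X) - b‖`. -/
def IsSDPSolution {L₁ L₂ : ℕ} (K : Set (Matrix (Fin L₁ ⊕ Fin L₂) (Fin L₁ ⊕ Fin L₂) ℂ))
    (b : EuclideanSpace ℂ (MeasIdx L₁ L₂))
    (Xhat : Matrix (Fin L₁ ⊕ Fin L₂) (Fin L₁ ⊕ Fin L₂) ℂ) : Prop :=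
  Xhat ∈ K ∧ IsMinOn (fun X => ‖measMap X - b‖) K Xhat

/-! ### Sylvester matrices and the second smallest eigenvalue -/

/-- The vector `x⁰ = (x, 0)`. -/
def addZero {L : ℕ} (x : Fin L → ℝ) : Fin (L + 1) → ℝ := Fin.snoc x 0

/-- The banded Toeplitz matrix with `M` rows and `q` columns whose columns are the successive down
shifts of `a` (padded with zeros); with `M = p + q - 1` it is the matrix of `v ↦ a * v`. -/
def bandedToeplitz {p : ℕ} (M q : ℕ) (a : Fin p → ℝ) : Matrix (Fin M) (Fin q) ℝ :=
  Matrix.of fun r c =>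
    if h : (c : ℕ) ≤ (r : ℕ) ∧ (r : ℕ) - (c : ℕ) < p then a ⟨(r : ℕ) - (c : ℕ), h.2⟩ else 0

/-- The `N × N` Sylvester matrix `S_{a,b} = (T_{L₁,a}  T_{L₂,b})`, of `a` of length `L₂ + 1` and
`b` of length `L₁ + 1`, where `N = L₁ + L₂`. -/
def sylvester {L₁ L₂ : ℕ} (a : Fin (L₂ + 1) → ℝ) (b : Fin (L₁ + 1) → ℝ) :
    Matrix (Fin (L₁ + L₂)) (Fin L₁ ⊕ Fin L₂) ℝ :=
  Matrix.fromCols (bandedToeplitz (L₁ + L₂) L₁ a) (bandedToeplitz (L₁ + L₂) L₂ b)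

/-- `λ₂(SᵀS)`: eigenvalues with multiplicity, ordered increasingly (Mathlib's `eigenvalues₀` is
decreasing). The `else` branch concerns only matrices with fewer than two columns. -/
noncomputable def gramLambdaTwo {m n : Type*} [Fintype m] [Fintype n] [DecidableEq n]
    (S : Matrix m n ℝ) : ℝ :=
  if h : 2 ≤ Fintype.card n then
    (Matrix.isHermitian_conjTranspose_mul_self S).eigenvalues₀
      ⟨Fintype.card n - 2, by omega⟩
  else 0

/-- `λ₂(W)` for `W = S*S`, `S = S_{x̃₂⁰,-x̃₁⁰}`, and `x̃ᵢ = xᵢ / ‖x‖`. -/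
noncomputable def lambdaTwoW {L₁ L₂ : ℕ} (x₁ : Fin L₁ → ℝ) (x₂ : Fin L₂ → ℝ) : ℝ :=
  gramLambdaTwo (sylvester
    (addZero (‖stack x₁ x₂‖⁻¹ • x₂)) (-addZero (‖stack x₁ x₂‖⁻¹ • x₁)))

/-- `λ₂(W₋)` for `W₋ = S₋*S₋`, `S₋ = S_{x̃₂⁻⁰,-x̃₁⁰}`, and `x̃ᵢ = xᵢ / ‖x‖`. -/
noncomputable def lambdaTwoWminus {L₁ L₂ : ℕ} (x₁ : Fin L₁ → ℝ) (x₂ : Fin L₂ → ℝ) : ℝ :=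
  gramLambdaTwo (sylvester
    (addZero (reversal (‖stack x₁ x₂‖⁻¹ • x₂))) (-addZero (‖stack x₁ x₂‖⁻¹ • x₁)))

/-- The stability constant. -/
noncomputable def stabilityConst {L₁ L₂ : ℕ} (x₁ : Fin L₁ → ℝ) (x₂ : Fin L₂ → ℝ) : ℝ :=
  2 * ((L₁ : ℝ) + L₂) *
    (23 * ((L₁ : ℝ) + L₂) ^ 2 / (lambdaTwoW x₁ x₂ * √(lambdaTwoWminus x₁ x₂))
      + 1 / lambdaTwoW x₁ x₂
      + 4 * √2 / √(lambdaTwoWminus x₁ x₂))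

end BlindDeconv

/-! After normalizing `x` to unit length, put `Q = x xᵀ`; the error `X - c Q` is split into its
compression to the complement of `x` and a tangent element `x h* + h x*`, and each part is bounded
by the measurements.

The kernel of the Sylvester matrix encodes the polynomial equation `p_{x₂} v₁ = p_{x₁} v₂`. It
always contains `x`, and it is the line through `x` exactly when the two polynomials are coprime;
this is part (a) (`gramLambdaTwo_sylvester_pos_iff`).

Compression: `W` is a dual certificate. It annihilates `x`, it satisfies `W ≥ λ₂ (1 - Q)`, and it is
block Toeplitz, so `tr (W X)` depends on the measurements alone. For `X ≥ 0` this gives `λ₂ tr ((1 -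
Q) X (1 - Q)) ≤ tr (W X) = tr (W (X - c Q)) ≤ N ‖𝒜(X - c Q)‖` (`norm_compression_le`).

Tangent part: the cross-correlation of `x h* + h x*` is `S₋` applied to the reflected direction
`(h₁, -conj h₂⁻)`. The gap of `W₋` controls this vector except along `(x₁, x₂⁻)`. The real part of
that missing coefficient is read off the zero-lag autocorrelations; the imaginary part is a phase
rotation, which leaves the tangent element unchanged (`norm_tangent_le_measMap`).

The tangent part has measurements `𝒜(X - c Q) - 𝒜(M)`, with `M` the compression, and `‖𝒜(M)‖ ≤ N
‖M‖`. Optimality gives `‖𝒜(X̂ - x x*)‖ ≤ 2 ‖n‖`. -/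

namespace BlindDeconv

open Matrix

/-! ### Spectral gap of Gram matrices; positive semidefinite and Frobenius estimates -/

section Spectral

variable {m n : Type*} [Fintype m] [Fintype n]

/-- Parseval's identity for the eigenbasis of a real symmetric matrix. -/
lemma dotProduct_eq_sum_eigenvectorBasis [DecidableEq n] {A : Matrix n n ℝ}
    (hA : A.IsHermitian) (u v : n → ℝ) :
    u ⬝ᵥ v = ∑ i, (⇑(hA.eigenvectorBasis i) ⬝ᵥ u) * (⇑(hA.eigenvectorBasis i) ⬝ᵥ v) := by
  have h := hA.eigenvectorBasis.sum_inner_mul_inner (WithLp.toLp 2 u) (WithLp.toLp 2 v)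
  simp only [EuclideanSpace.inner_eq_star_dotProduct, star_trivial] at h
  rw [dotProduct_comm u v, ← h]
  refine Finset.sum_congr rfl fun i _ => ?_
  rw [dotProduct_comm _ v]

lemma eigenvectorBasis_dotProduct_mulVec [DecidableEq n] {A : Matrix n n ℝ}
    (hA : A.IsHermitian) (v : n → ℝ) (i : n) :
    ⇑(hA.eigenvectorBasis i) ⬝ᵥ (A *ᵥ v)
      = hA.eigenvalues i * (⇑(hA.eigenvectorBasis i) ⬝ᵥ v) := by
  have hT : Aᵀ = A := by simpa [IsHermitian, conjTranspose_eq_transpose_of_trivial] using hA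
  rw [dotProduct_mulVec, ← mulVec_transpose, hT, hA.mulVec_eigenvectorBasis, smul_dotProduct,
    smul_eq_mul]

lemma mulVec_dotProduct_self_eq_sum [DecidableEq n] (S : Matrix m n ℝ) (v : n → ℝ) :
    (S *ᵥ v) ⬝ᵥ (S *ᵥ v) = ∑ i, (isHermitian_conjTranspose_mul_self S).eigenvalues i
      * (⇑((isHermitian_conjTranspose_mul_self S).eigenvectorBasis i) ⬝ᵥ v) ^ 2 := by
  have h1 : (S *ᵥ v) ⬝ᵥ (S *ᵥ v) = v ⬝ᵥ ((Sᴴ * S) *ᵥ v) := by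
    rw [← mulVec_mulVec, dotProduct_mulVec v, vecMul_conjTranspose, star_trivial, star_trivial]
  rw [h1, dotProduct_eq_sum_eigenvectorBasis (isHermitian_conjTranspose_mul_self S)]
  refine Finset.sum_congr rfl fun i _ => ?_
  rw [eigenvectorBasis_dotProduct_mulVec]
  ring

lemma mulVec_eigenvectorBasis_dotProduct_self [DecidableEq n] (S : Matrix m n ℝ) (i : n) :
    (S *ᵥ ⇑((isHermitian_conjTranspose_mul_self S).eigenvectorBasis i)) ⬝ᵥ
      (S *ᵥ ⇑((isHermitian_conjTranspose_mul_self S).eigenvectorBasis i))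
      = (isHermitian_conjTranspose_mul_self S).eigenvalues i := by
  set e := ⇑((isHermitian_conjTranspose_mul_self S).eigenvectorBasis i)
  have h1 : (S *ᵥ e) ⬝ᵥ (S *ᵥ e) = e ⬝ᵥ ((Sᴴ * S) *ᵥ e) := by
    rw [← mulVec_mulVec, dotProduct_mulVec e, vecMul_conjTranspose, star_trivial, star_trivial]
  have h2 := (isHermitian_conjTranspose_mul_self S).eigenvalues_eq i
  rw [h1, h2]
  simp [e]

/-- There are two distinct eigenvector indices carrying the two smallest eigenvalues of the Gram
matrix, the larger of which is `gramLambdaTwo`. -/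
lemma exists_index_gramLambdaTwo [DecidableEq n] (S : Matrix m n ℝ) (hn : 2 ≤ Fintype.card n) :
    ∃ i₀ i₁ : n, i₀ ≠ i₁ ∧
      (isHermitian_conjTranspose_mul_self S).eigenvalues i₁ = gramLambdaTwo S ∧
      (isHermitian_conjTranspose_mul_self S).eigenvalues i₀ ≤ gramLambdaTwo S ∧
      ∀ i, i ≠ i₀ → gramLambdaTwo S ≤ (isHermitian_conjTranspose_mul_self S).eigenvalues i := by
  set hA := isHermitian_conjTranspose_mul_self S
  let φ : Fin (Fintype.card n) ≃ n := Fintype.equivOfCardEq (Fintype.card_fin _)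
  have hev : ∀ j, hA.eigenvalues (φ j) = hA.eigenvalues₀ j := fun j => by
    simp [IsHermitian.eigenvalues, φ]
  have hg : gramLambdaTwo S = hA.eigenvalues₀ ⟨Fintype.card n - 2, by omega⟩ := by
    simp [gramLambdaTwo, hn]
  -- `eigenvalues₀` is decreasing, so the last two positions carry the two smallest eigenvalues.
  refine ⟨φ ⟨Fintype.card n - 1, by omega⟩, φ ⟨Fintype.card n - 2, by omega⟩, ?_, ?_, ?_, ?_⟩
  · intro h
    have := congrArg Fin.val (φ.injective h)
    simp only at this
    omega
  · rw [hev, hg]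
  · rw [hev, hg]
    exact hA.eigenvalues₀_antitone (by simp only [Fin.mk_le_mk]; omega)
  · intro i hi
    obtain ⟨j, rfl⟩ := φ.surjective i
    rw [hev, hg]
    refine hA.eigenvalues₀_antitone ?_
    have hj : (j : ℕ) ≠ Fintype.card n - 1 := fun h => hi (by congr 1; exact Fin.ext h)
    have := j.2
    rw [Fin.le_def]
    simp only
    omega

lemma gramLambdaTwo_le_trace [DecidableEq n] (S : Matrix m n ℝ) (hn : 2 ≤ Fintype.card n) :
    gramLambdaTwo S ≤ (Sᴴ * S).trace := by
  obtain ⟨_, i₁, -, h, -⟩ := exists_index_gramLambdaTwo S hn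
  rw [(isHermitian_conjTranspose_mul_self S).trace_eq_sum_eigenvalues, ← h]
  exact Finset.single_le_sum
    (f := fun i => (isHermitian_conjTranspose_mul_self S).eigenvalues i)
    (fun i _ => (posSemidef_conjTranspose_mul_self S).eigenvalues_nonneg i) (Finset.mem_univ i₁)

/-- If the kernel of `S` is at most one-dimensional, then the second smallest eigenvalue of the
Gram matrix is positive. -/
lemma gramLambdaTwo_pos [DecidableEq n] (S : Matrix m n ℝ) (hn : 2 ≤ Fintype.card n) (x : n → ℝ)
    (hker : ∀ v, S *ᵥ v = 0 → ∃ c : ℝ, v = c • x) : 0 < gramLambdaTwo S := by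
  obtain ⟨i₀, i₁, hne, h1, h0, -⟩ := exists_index_gramLambdaTwo S hn
  by_contra hneg
  have hz : ∀ i, (isHermitian_conjTranspose_mul_self S).eigenvalues i ≤ 0 →
      ∃ c : ℝ, ⇑((isHermitian_conjTranspose_mul_self S).eigenvectorBasis i) = c • x := by
    intro i hi
    apply hker
    rw [← dotProduct_self_eq_zero, mulVec_eigenvectorBasis_dotProduct_self]
    exact le_antisymm hi ((posSemidef_conjTranspose_mul_self S).eigenvalues_nonneg i)
  obtain ⟨c, hc⟩ := hz i₀ (h0.trans (not_lt.mp hneg))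
  obtain ⟨d, hd⟩ := hz i₁ (h1.le.trans (not_lt.mp hneg))
  have ho := orthonormal_iff_ite.mp
    (isHermitian_conjTranspose_mul_self S).eigenvectorBasis.orthonormal
  have h00 := ho i₀ i₀
  have h11 := ho i₁ i₁
  have h01 := ho i₀ i₁
  simp only [EuclideanSpace.inner_eq_star_dotProduct, star_trivial, hc, hd, hne, if_true, if_false,
    smul_dotProduct, dotProduct_smul, smul_eq_mul] at h00 h11 h01
  -- Two multiples of one vector give equality in Cauchy–Schwarz, which for orthonormal vectors
  -- reads `1 = 0`.
  have : (c * (c * (x ⬝ᵥ x))) * (d * (d * (x ⬝ᵥ x))) = (c * (d * (x ⬝ᵥ x))) ^ 2 := by ring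
  rw [h00, h11, h01] at this
  norm_num at this

/-- Spectral gap estimate on the complement of a kernel vector. -/
lemma gramLambdaTwo_mul_le [DecidableEq n] (S : Matrix m n ℝ) (hn : 2 ≤ Fintype.card n)
    (x : n → ℝ) (hx : x ⬝ᵥ x = 1) (hSx : S *ᵥ x = 0) (hpos : 0 < gramLambdaTwo S) (v : n → ℝ) :
    gramLambdaTwo S * (v ⬝ᵥ v - (x ⬝ᵥ v) ^ 2) ≤ (S *ᵥ v) ⬝ᵥ (S *ᵥ v) := by
  obtain ⟨i₀, i₁, hne, h1, h0, hge⟩ := exists_index_gramLambdaTwo S hn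
  set hA := isHermitian_conjTranspose_mul_self S
  -- Eigenvectors with nonzero eigenvalue are orthogonal to the kernel, so the unit vector `x` is
  -- plus or minus the eigenvector at `i₀`; the square in `hxv` removes the sign.
  have hx0 : ∀ i, i ≠ i₀ → ⇑(hA.eigenvectorBasis i) ⬝ᵥ x = 0 := by
    intro i hi
    have h := eigenvectorBasis_dotProduct_mulVec hA x i
    rw [← mulVec_mulVec, hSx, mulVec_zero, dotProduct_zero] at h
    exact (mul_eq_zero.mp h.symm).resolve_left (hpos.trans_le (hge i hi)).ne'
  have hsum : ∀ w, x ⬝ᵥ w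
      = (⇑(hA.eigenvectorBasis i₀) ⬝ᵥ x) * (⇑(hA.eigenvectorBasis i₀) ⬝ᵥ w) := by
    intro w
    rw [dotProduct_eq_sum_eigenvectorBasis hA]
    refine Finset.sum_eq_single i₀ (fun i _ hi => ?_) (by simp)
    rw [hx0 i hi, zero_mul]
  have hxv : (x ⬝ᵥ v) ^ 2 = (⇑(hA.eigenvectorBasis i₀) ⬝ᵥ v) ^ 2 := by
    have := hsum x
    rw [hx] at this
    rw [hsum v, mul_pow, sq (_ ⬝ᵥ x), ← this, one_mul]
  rw [mulVec_dotProduct_self_eq_sum, hxv, dotProduct_eq_sum_eigenvectorBasis hA,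
    ← Finset.add_sum_erase _ _ (Finset.mem_univ i₀),
    ← Finset.add_sum_erase (a := i₀) _ (fun i => hA.eigenvalues i * _) (Finset.mem_univ i₀)]
  have e1 : ∀ a b : ℝ, a * a + b - a ^ 2 = b := fun a b => by ring
  rw [e1, Finset.mul_sum]
  refine le_add_of_nonneg_of_le (mul_nonneg
    ((posSemidef_conjTranspose_mul_self S).eigenvalues_nonneg i₀) (sq_nonneg _)) ?_
  refine Finset.sum_le_sum fun i hi => ?_
  rw [← sq]
  exact mul_le_mul_of_nonneg_right (hge i (Finset.ne_of_mem_erase hi)) (sq_nonneg _)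

/-- `v ⬝ᵥ v - (x ⬝ᵥ v) ^ 2` is the squared length of the component of `v` orthogonal to `x`, and the
gap estimate forces it to vanish. -/
lemma eq_smul_of_gramLambdaTwo_pos [DecidableEq n] (S : Matrix m n ℝ) (hn : 2 ≤ Fintype.card n)
    (x : n → ℝ) (hx : x ⬝ᵥ x = 1) (hSx : S *ᵥ x = 0) (hpos : 0 < gramLambdaTwo S) (v : n → ℝ)
    (hv : S *ᵥ v = 0) : v = (x ⬝ᵥ v) • x := by
  have h := gramLambdaTwo_mul_le S hn x hx hSx hpos v
  rw [hv, dotProduct_zero] at h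
  have h2 : v ⬝ᵥ v - (x ⬝ᵥ v) ^ 2 ≤ 0 := nonpos_of_mul_nonpos_right h hpos
  have h3 : (v - (x ⬝ᵥ v) • x) ⬝ᵥ (v - (x ⬝ᵥ v) • x) = v ⬝ᵥ v - (x ⬝ᵥ v) ^ 2 := by
    simp only [sub_dotProduct, dotProduct_sub, smul_dotProduct, dotProduct_smul, smul_eq_mul, hx,
      dotProduct_comm v x]
    ring
  have h4 : (v - (x ⬝ᵥ v) • x) ⬝ᵥ (v - (x ⬝ᵥ v) • x) = 0 :=
    le_antisymm (h3 ▸ h2) (Finset.sum_nonneg fun i _ => mul_self_nonneg _)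
  exact sub_eq_zero.mp (dotProduct_self_eq_zero.mp h4)

/-- The spectral gap as a positive semidefinite matrix. -/
lemma posSemidef_gram_sub [DecidableEq n] (S : Matrix m n ℝ) (hn : 2 ≤ Fintype.card n)
    (x : n → ℝ) (hx : x ⬝ᵥ x = 1) (hSx : S *ᵥ x = 0) (hpos : 0 < gramLambdaTwo S) :
    (Sᴴ * S - gramLambdaTwo S • (1 - vecMulVec x x)).PosSemidef := by
  refine .of_dotProduct_mulVec_nonneg ?_ fun v => ?_
  · refine (isHermitian_conjTranspose_mul_self S).sub ?_
    have : (vecMulVec x x).IsHermitian := by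
      ext i j
      simp [vecMulVec_apply, mul_comm]
    rw [IsHermitian, conjTranspose_smul, star_trivial, (isHermitian_one.sub this).eq]
  · have h := gramLambdaTwo_mul_le S hn x hx hSx hpos v
    have h1 : (S *ᵥ v) ⬝ᵥ (S *ᵥ v) = v ⬝ᵥ ((Sᴴ * S) *ᵥ v) := by
      rw [← mulVec_mulVec, dotProduct_mulVec v, vecMul_conjTranspose, star_trivial, star_trivial]
    rw [star_trivial, sub_mulVec, dotProduct_sub, ← h1, smul_mulVec, dotProduct_smul, sub_mulVec,
      one_mulVec, vecMulVec_mulVec, dotProduct_sub, sub_nonneg]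
    have h2 : v ⬝ᵥ (MulOpposite.op (x ⬝ᵥ v) • x) = (x ⬝ᵥ v) ^ 2 := by
      rw [op_smul_eq_smul, dotProduct_smul, dotProduct_comm v x, smul_eq_mul, sq]
    rwa [h2, smul_eq_mul]

open scoped MatrixOrder in
lemma exists_eq_conjTranspose_mul_self {𝕜 : Type*} [RCLike 𝕜] {A : Matrix n n 𝕜}
    (hA : A.PosSemidef) : ∃ B : Matrix n n 𝕜, A = Bᴴ * B := by
  classical
  obtain ⟨B, hB⟩ := CStarAlgebra.nonneg_iff_eq_star_mul_self.mp hA.nonneg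
  exact ⟨B, hB⟩

lemma posSemidef_map_ofReal {A : Matrix n n ℝ} (hA : A.PosSemidef) :
    (A.map Complex.ofReal).PosSemidef := by
  obtain ⟨B, rfl⟩ := exists_eq_conjTranspose_mul_self hA
  have : (Bᴴ * B).map Complex.ofReal = (B.map Complex.ofReal)ᴴ * B.map Complex.ofReal := by
    ext i j
    simp [mul_apply]
  rw [this]
  exact posSemidef_conjTranspose_mul_self _

lemma trace_mul_re_nonneg {A B : Matrix n n ℂ} (hA : A.PosSemidef) (hB : B.PosSemidef) :
    0 ≤ (A * B).trace.re := by
  obtain ⟨C, rfl⟩ := exists_eq_conjTranspose_mul_self hB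
  rw [← Matrix.mul_assoc, trace_mul_comm, ← Matrix.mul_assoc]
  exact (Complex.le_def.mp (hA.mul_mul_conjTranspose_same C).trace_nonneg).1

lemma frobenius_norm_sq {𝕜 : Type*} [RCLike 𝕜] (A : Matrix m n 𝕜) :
    ‖A‖ ^ 2 = ∑ i, ∑ j, ‖A i j‖ ^ 2 := by
  rw [frobenius_norm_def, ← Real.sqrt_eq_rpow, Real.sq_sqrt (by positivity)]
  simp

lemma frobenius_norm_sq_eq_trace {𝕜 : Type*} [RCLike 𝕜] (A : Matrix m n 𝕜) :
    ‖A‖ ^ 2 = RCLike.re (Aᴴ * A).trace := by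
  rw [frobenius_norm_sq, Finset.sum_comm]
  simp only [trace, mul_apply, conjTranspose_apply, diag_apply, RCLike.star_def, map_sum]
  refine Finset.sum_congr rfl fun i _ => Finset.sum_congr rfl fun j _ => ?_
  rw [RCLike.conj_mul, ← RCLike.ofReal_pow, RCLike.ofReal_re]

/-- Submultiplicativity gives `‖Bᴴ B‖ ≤ ‖B‖²`, and `‖B‖²` is the trace of `Bᴴ B`. -/
lemma frobenius_norm_le_trace {𝕜 : Type*} [RCLike 𝕜] {A : Matrix n n 𝕜} (hA : A.PosSemidef) :
    ‖A‖ ≤ RCLike.re A.trace := by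
  obtain ⟨B, rfl⟩ := exists_eq_conjTranspose_mul_self hA
  rw [← frobenius_norm_sq_eq_trace, sq]
  refine (frobenius_norm_mul _ _).trans_eq ?_
  rw [frobenius_norm_conjTranspose]

end Spectral

/-! ### Sylvester kernels and coprimality -/

section Polynomials

open Polynomial

lemma coeff_zPoly {L : ℕ} (u : Fin L → ℝ) (c : Fin L) : (zPoly u).coeff (L - 1 - c) = u c := by
  simp only [zPoly, finsetSum_coeff, coeff_C_mul, coeff_X_pow]
  rw [Finset.sum_eq_single c]
  · simp
  · intro k _ hk
    have hne : L - 1 - (c : ℕ) ≠ L - 1 - (k : ℕ) := fun h => hk (Fin.ext (by omega))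
    simp [hne]
  · simp

lemma degree_zPoly_lt {L : ℕ} (u : Fin L → ℝ) : (zPoly u).degree < L := by
  refine (degree_sum_le _ _).trans_lt ((Finset.sup_lt_iff (WithBot.bot_lt_coe L)).mpr ?_)
  intro k _
  refine (degree_C_mul_X_pow_le _ _).trans_lt ?_
  exact Nat.cast_lt.mpr (by omega)

lemma zPoly_injective {L : ℕ} : Function.Injective (zPoly (L := L)) := fun u v h => by
  funext c
  rw [← coeff_zPoly u, h, coeff_zPoly]

lemma exists_zPoly_eq {L : ℕ} (P : ℝ[X]) (hP : P.degree < L) : ∃ u : Fin L → ℝ, zPoly u = P := by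
  refine ⟨fun c => P.coeff (L - 1 - c), Polynomial.ext fun k => ?_⟩
  by_cases hk : k < L
  · have := coeff_zPoly (fun c : Fin L => P.coeff (L - 1 - c)) ⟨L - 1 - k, by omega⟩
    have hk' : L - 1 - (L - 1 - k) = k := by omega
    simpa only [hk'] using this
  · have hk' : (L : WithBot ℕ) ≤ k := by exact_mod_cast not_lt.mp hk
    rw [coeff_eq_zero_of_degree_lt ((degree_zPoly_lt _).trans_le hk'),
      coeff_eq_zero_of_degree_lt (hP.trans_le hk')]

lemma zPoly_smul {L : ℕ} (c : ℝ) (u : Fin L → ℝ) : zPoly (c • u) = C c * zPoly u := by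
  simp [zPoly, Finset.mul_sum, mul_assoc]

lemma zPoly_neg {L : ℕ} (u : Fin L → ℝ) : zPoly (-u) = -zPoly u := by
  simp [zPoly]

/-- Coefficients are listed from the top degree down, so a trailing zero raises every degree by one.
-/
lemma zPoly_addZero {L : ℕ} (u : Fin L → ℝ) : zPoly (addZero u) = X * zPoly u := by
  simp only [zPoly, addZero, Fin.sum_univ_castSucc, Fin.snoc_castSucc, Fin.snoc_last, Finset.mul_sum]
  simp only [map_zero, zero_mul, add_zero]
  refine Finset.sum_congr rfl fun k _ => ?_
  have : L + 1 - 1 - (k.castSucc : ℕ) = (L - 1 - k) + 1 := by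
    simp only [Fin.val_castSucc]; omega
  rw [this, pow_succ]
  ring

lemma natDegree_zPoly {L : ℕ} (hL : 0 < L) (u : Fin L → ℝ) (hu : u ⟨0, hL⟩ ≠ 0) :
    (zPoly u).natDegree = L - 1 := by
  have h := coeff_zPoly u ⟨0, hL⟩
  simp only [tsub_zero] at h
  refine le_antisymm ?_ (le_natDegree_of_ne_zero (h ▸ hu))
  have hne : zPoly u ≠ 0 := fun h0 => hu (by rw [← h, h0, coeff_zero])
  have := degree_zPoly_lt u
  rw [degree_eq_natDegree hne] at this
  have : (zPoly u).natDegree < L := by exact_mod_cast this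
  omega

lemma bandedToeplitz_apply_eq_sum {p M q : ℕ} (a : Fin p → ℝ) (r : Fin M) (c : Fin q) :
    bandedToeplitz M q a r c = ∑ i : Fin p, if (i : ℕ) + c = r then a i else 0 := by
  simp only [bandedToeplitz, of_apply]
  split_ifs with h
  · rw [Finset.sum_eq_single ⟨(r : ℕ) - c, h.2⟩]
    · simp [Nat.sub_add_cancel h.1]
    · intro i _ hi
      exact if_neg fun h' => hi (Fin.ext (by simp only; omega))
    · simp
  · refine (Finset.sum_eq_zero fun i _ => if_neg fun h' => h ⟨by omega, ?_⟩).symm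
    have := i.2
    omega

/-- The matrix `bandedToeplitz` implements polynomial multiplication. -/
lemma bandedToeplitz_mulVec {p q M : ℕ} (hM : M + 1 = p + q) (a : Fin p → ℝ) (u : Fin q → ℝ)
    (r : Fin M) :
    (bandedToeplitz M q a *ᵥ u) r = (zPoly a * zPoly u).coeff (M - 1 - r) := by
  have hprod : zPoly a * zPoly u
      = ∑ c, ∑ i, C (a i * u c) * X ^ (p - 1 - (i : ℕ) + (q - 1 - (c : ℕ))) := by
    rw [zPoly, zPoly, Finset.sum_mul_sum, Finset.sum_comm]
    refine Finset.sum_congr rfl fun c _ => Finset.sum_congr rfl fun i _ => ?_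
    rw [pow_add, C_mul]
    ring
  rw [hprod]
  simp only [mulVec, dotProduct, bandedToeplitz_apply_eq_sum, finsetSum_coeff, coeff_C_mul,
    coeff_X_pow, Finset.sum_mul]
  refine Finset.sum_congr rfl fun c _ => Finset.sum_congr rfl fun i _ => ?_
  have hiff : ((i : ℕ) + c = r) ↔ M - 1 - (r : ℕ) = p - 1 - (i : ℕ) + (q - 1 - (c : ℕ)) := by
    have := i.2
    have := c.2
    have := r.2
    omega
  simp only [hiff]
  split_ifs <;> simp

variable {L₁ L₂ : ℕ}

lemma sylvester_mulVec (x₁ : Fin L₁ → ℝ) (x₂ : Fin L₂ → ℝ) (v : Fin L₁ ⊕ Fin L₂ → ℝ)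
    (r : Fin (L₁ + L₂)) :
    (sylvester (addZero x₂) (-addZero x₁) *ᵥ v) r =
      (X * (zPoly x₂ * zPoly (v ∘ Sum.inl) - zPoly x₁ * zPoly (v ∘ Sum.inr))).coeff
        (L₁ + L₂ - 1 - r) := by
  have hpoly : X * (zPoly x₂ * zPoly (v ∘ Sum.inl) - zPoly x₁ * zPoly (v ∘ Sum.inr))
      = zPoly (addZero x₂) * zPoly (v ∘ Sum.inl)
        + zPoly (-addZero x₁) * zPoly (v ∘ Sum.inr) := by
    rw [zPoly_neg, zPoly_addZero, zPoly_addZero]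
    ring
  rw [hpoly, coeff_add, ← bandedToeplitz_mulVec (by omega), ← bandedToeplitz_mulVec (by omega),
    ← Pi.add_apply, sylvester, fromCols_mulVec]

/-- The difference of products has degree below `L₁ + L₂ - 1`. After multiplication by `X` the rows
of the matrix read all its coefficients; the last row reads the constant one, which is always zero.
-/
lemma sylvester_mulVec_eq_zero_iff (x₁ : Fin L₁ → ℝ) (x₂ : Fin L₂ → ℝ)
    (v : Fin L₁ ⊕ Fin L₂ → ℝ) :
    sylvester (addZero x₂) (-addZero x₁) *ᵥ v = 0 ↔
      zPoly x₂ * zPoly (v ∘ Sum.inl) = zPoly x₁ * zPoly (v ∘ Sum.inr) := by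
  constructor
  · intro h
    have hdeg : (zPoly x₂ * zPoly (v ∘ Sum.inl) - zPoly x₁ * zPoly (v ∘ Sum.inr)).degree
        < (L₁ + L₂ - 1 : ℕ) := by
      have hmul : ∀ {p q : ℕ} (a : Fin p → ℝ) (u : Fin q → ℝ),
          (zPoly a * zPoly u).degree < (p + q - 1 : ℕ) := by
        intro p q a u
        by_cases ha : zPoly a = 0
        · simp [ha]
        by_cases hu : zPoly u = 0
        · simp [hu]
        have h1 := degree_zPoly_lt a
        have h2 := degree_zPoly_lt u
        rw [degree_eq_natDegree ha, Nat.cast_lt] at h1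
        rw [degree_eq_natDegree hu, Nat.cast_lt] at h2
        rw [degree_mul, degree_eq_natDegree ha, degree_eq_natDegree hu, ← Nat.cast_add,
          Nat.cast_lt]
        omega
      refine (degree_sub_le _ _).trans_lt (max_lt ?_ (hmul _ _))
      rw [add_comm L₁]
      exact hmul _ _
    refine sub_eq_zero.mp (Polynomial.ext fun k => ?_)
    by_cases hk : k < L₁ + L₂ - 1
    · have := congrFun h ⟨L₁ + L₂ - 1 - (k + 1), by omega⟩
      rw [sylvester_mulVec] at this
      have hk' : L₁ + L₂ - 1 - (L₁ + L₂ - 1 - (k + 1)) = k + 1 := by omega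
      simp only [hk', coeff_X_mul, Pi.zero_apply] at this
      simpa using this
    · rw [coeff_zero]
      exact coeff_eq_zero_of_degree_lt (hdeg.trans_le (by exact_mod_cast not_lt.mp hk))
  · intro h
    funext r
    rw [sylvester_mulVec, h]
    simp

/-- Commutativity of convolution makes the signal itself a null vector. -/
lemma sylvester_mulVec_self (x₁ : Fin L₁ → ℝ) (x₂ : Fin L₂ → ℝ) :
    sylvester (addZero x₂) (-addZero x₁) *ᵥ Sum.elim x₁ x₂ = 0 := by
  rw [sylvester_mulVec_eq_zero_iff, Sum.elim_comp_inl, Sum.elim_comp_inr, mul_comm]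

/-- The second smallest eigenvalue of the Sylvester Gram matrix is positive exactly when the two
signals share no zeros. -/
lemma gramLambdaTwo_sylvester_pos_iff (hL₁ : 0 < L₁) (hL₂ : 0 < L₂) (x₁ : Fin L₁ → ℝ)
    (x₂ : Fin L₂ → ℝ) (hx₁ : x₁ ⟨0, hL₁⟩ ≠ 0)
    (hx : Sum.elim x₁ x₂ ⬝ᵥ Sum.elim x₁ x₂ = 1) :
    0 < gramLambdaTwo (sylvester (addZero x₂) (-addZero x₁)) ↔
      IsCoprime (zPoly x₁) (zPoly x₂) := by
  have hcard : 2 ≤ Fintype.card (Fin L₁ ⊕ Fin L₂) := by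
    simp only [Fintype.card_sum, Fintype.card_fin]; omega
  have hp₁ : zPoly x₁ ≠ 0 := fun h0 => hx₁ (by rw [← coeff_zPoly x₁, h0, coeff_zero])
  constructor
  · intro hpos
    -- Dividing both signals by their gcd gives a second kernel vector of the same lengths.
    -- One-dimensionality makes it a multiple `c` of the signal, so `q₁ = c g q₁` and `g` is a unit.
    obtain ⟨q₁, hq₁⟩ := EuclideanDomain.gcd_dvd_left (zPoly x₁) (zPoly x₂)
    obtain ⟨q₂, hq₂⟩ := EuclideanDomain.gcd_dvd_right (zPoly x₁) (zPoly x₂)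
    set g := EuclideanDomain.gcd (zPoly x₁) (zPoly x₂) with hg
    have hq₁0 : q₁ ≠ 0 := fun h => hp₁ (by rw [hq₁, h, mul_zero])
    have hg0 : g ≠ 0 := fun h => hp₁ (by rw [hq₁, h, zero_mul])
    have hdeg : ∀ {q : ℝ[X]} {L : ℕ}, (g * q).degree < L → q.degree < L := by
      intro q L h
      rw [degree_mul] at h
      exact lt_of_le_of_lt (le_add_of_nonneg_left (zero_le_degree_iff.mpr hg0)) h
    obtain ⟨w₁, hw₁⟩ := exists_zPoly_eq (L := L₁) q₁ (hdeg (hq₁ ▸ degree_zPoly_lt x₁))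
    obtain ⟨w₂, hw₂⟩ := exists_zPoly_eq (L := L₂) q₂ (hdeg (hq₂ ▸ degree_zPoly_lt x₂))
    have hker : sylvester (addZero x₂) (-addZero x₁) *ᵥ Sum.elim w₁ w₂ = 0 := by
      rw [sylvester_mulVec_eq_zero_iff, Sum.elim_comp_inl, Sum.elim_comp_inr, hw₁, hw₂]
      nth_rewrite 1 [hq₂]
      nth_rewrite 1 [hq₁]
      ring
    have hw := eq_smul_of_gramLambdaTwo_pos _ hcard _ hx (sylvester_mulVec_self x₁ x₂) hpos _ hker
    set c := Sum.elim x₁ x₂ ⬝ᵥ Sum.elim w₁ w₂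
    have hwc : w₁ = c • x₁ := by
      funext i
      simpa using congrFun hw (Sum.inl i)
    have hq : q₁ * 1 = q₁ * (C c * g) := by
      rw [mul_one]
      nth_rewrite 1 [← hw₁, hwc, zPoly_smul, hq₁]
      ring
    have hu : IsUnit g := IsUnit.of_mul_eq_one _ ((mul_comm _ _).trans (mul_left_cancel₀ hq₁0 hq).symm)
    exact EuclideanDomain.gcd_isUnit_iff.mp hu
  · intro hcop
    refine gramLambdaTwo_pos _ hcard (Sum.elim x₁ x₂) fun v hv => ?_
    rw [sylvester_mulVec_eq_zero_iff] at hv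
    obtain ⟨k, hk⟩ : zPoly x₁ ∣ zPoly (v ∘ Sum.inl) :=
      hcop.dvd_of_dvd_mul_left ⟨_, hv⟩
    -- The nonzero first coefficient gives `zPoly x₁` the full degree `L₁ - 1`, leaving no room for
    -- a nonconstant cofactor.
    have hkdeg : k.degree ≤ 0 := by
      by_cases hk0 : k = 0
      · simp [hk0]
      have h := degree_zPoly_lt (v ∘ Sum.inl)
      rw [hk, degree_mul, degree_eq_natDegree hp₁, degree_eq_natDegree hk0,
        natDegree_zPoly hL₁ x₁ hx₁, ← Nat.cast_add, Nat.cast_lt] at h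
      rw [← natDegree_eq_zero_iff_degree_le_zero]
      omega
    have hkc := eq_C_of_degree_le_zero hkdeg
    set c := k.coeff 0
    have h1 : v ∘ Sum.inl = c • x₁ := zPoly_injective (by rw [zPoly_smul, hk, hkc, mul_comm])
    have h2 : v ∘ Sum.inr = c • x₂ := by
      refine zPoly_injective (mul_left_cancel₀ hp₁ ?_)
      rw [← hv, h1, zPoly_smul, zPoly_smul]
      ring
    refine ⟨c, funext fun i => ?_⟩
    rcases i with i | i
    · simpa using congrFun h1 i
    · simpa using congrFun h2 i

lemma isCoprime_zPoly_smul_iff {c : ℝ} (hc : c ≠ 0) (x₁ : Fin L₁ → ℝ) (x₂ : Fin L₂ → ℝ) :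
    IsCoprime (zPoly (c • x₁)) (zPoly (c • x₂)) ↔ IsCoprime (zPoly x₁) (zPoly x₂) := by
  have hu : IsUnit (C c) := isUnit_C.mpr hc.isUnit
  rw [zPoly_smul, zPoly_smul, isCoprime_mul_unit_left_left hu, isCoprime_mul_unit_left_right hu]

end Polynomials

/-! ### Passage to unit signals; part (a) -/

section Normalization

variable {L₁ L₂ : ℕ}

lemma norm_stack_sq (x₁ : Fin L₁ → ℝ) (x₂ : Fin L₂ → ℝ) :
    ‖stack x₁ x₂‖ ^ 2 = Sum.elim x₁ x₂ ⬝ᵥ Sum.elim x₁ x₂ := by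
  rw [EuclideanSpace.norm_sq_eq]
  simp [stack, dotProduct, sq]

lemma norm_stack_pos (hL₁ : 0 < L₁) (x₁ : Fin L₁ → ℝ) (x₂ : Fin L₂ → ℝ)
    (hx₁ : x₁ ⟨0, hL₁⟩ ≠ 0) : 0 < ‖stack x₁ x₂‖ := by
  rw [norm_pos_iff]
  intro h
  exact hx₁ (congrArg (fun v : EuclideanSpace ℝ (Fin L₁ ⊕ Fin L₂) => v (Sum.inl ⟨0, hL₁⟩)) h)

lemma dotProduct_normalized (hL₁ : 0 < L₁) (x₁ : Fin L₁ → ℝ) (x₂ : Fin L₂ → ℝ)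
    (hx₁ : x₁ ⟨0, hL₁⟩ ≠ 0) :
    Sum.elim (‖stack x₁ x₂‖⁻¹ • x₁) (‖stack x₁ x₂‖⁻¹ • x₂) ⬝ᵥ
      Sum.elim (‖stack x₁ x₂‖⁻¹ • x₁) (‖stack x₁ x₂‖⁻¹ • x₂) = 1 := by
  have h : Sum.elim (‖stack x₁ x₂‖⁻¹ • x₁) (‖stack x₁ x₂‖⁻¹ • x₂)
      = ‖stack x₁ x₂‖⁻¹ • Sum.elim x₁ x₂ := by
    funext i
    rcases i with i | i <;> rfl
  have hpos := norm_stack_pos hL₁ x₁ x₂ hx₁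
  rw [h, smul_dotProduct, dotProduct_smul, ← norm_stack_sq, smul_eq_mul, smul_eq_mul]
  field_simp

lemma dotProduct_elim_reversal (x₁ : Fin L₁ → ℝ) (x₂ : Fin L₂ → ℝ) :
    Sum.elim x₁ (reversal x₂) ⬝ᵥ Sum.elim x₁ (reversal x₂)
      = Sum.elim x₁ x₂ ⬝ᵥ Sum.elim x₁ x₂ := by
  simp only [dotProduct, Fintype.sum_sum_type, Sum.elim_inl, Sum.elim_inr, reversal]
  congr 1
  exact Fintype.sum_equiv Fin.revPerm _ _ fun _ => rfl

lemma lambdaTwoW_pos_iff (hL₁ : 0 < L₁) (hL₂ : 0 < L₂) (x₁ : Fin L₁ → ℝ) (x₂ : Fin L₂ → ℝ)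
    (hx₁ : x₁ ⟨0, hL₁⟩ ≠ 0) :
    0 < lambdaTwoW x₁ x₂ ↔ IsCoprime (zPoly x₁) (zPoly x₂) := by
  have hpos := inv_pos.mpr (norm_stack_pos hL₁ x₁ x₂ hx₁)
  rw [lambdaTwoW, gramLambdaTwo_sylvester_pos_iff hL₁ hL₂ _ _ (mul_ne_zero hpos.ne' hx₁)
    (dotProduct_normalized hL₁ x₁ x₂ hx₁), isCoprime_zPoly_smul_iff hpos.ne']

lemma lambdaTwoWminus_pos_iff (hL₁ : 0 < L₁) (hL₂ : 0 < L₂) (x₁ : Fin L₁ → ℝ)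
    (x₂ : Fin L₂ → ℝ) (hx₁ : x₁ ⟨0, hL₁⟩ ≠ 0) :
    0 < lambdaTwoWminus x₁ x₂ ↔ IsCoprime (zPoly x₁) (zPoly (reversal x₂)) := by
  have hpos := inv_pos.mpr (norm_stack_pos hL₁ x₁ x₂ hx₁)
  rw [lambdaTwoWminus, gramLambdaTwo_sylvester_pos_iff hL₁ hL₂ _ _ (mul_ne_zero hpos.ne' hx₁)
    ((dotProduct_elim_reversal _ _).trans (dotProduct_normalized hL₁ x₁ x₂ hx₁)),
    ← isCoprime_zPoly_smul_iff hpos.ne' x₁ (reversal x₂)]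
  rfl

end Normalization

/-! ### The measurement map and block Toeplitz certificates -/

section Measurements

variable {L₁ L₂ : ℕ}

/-- The measurement to which an entry of the lifted matrix contributes. -/
def lagIndex : Fin L₁ ⊕ Fin L₂ → Fin L₁ ⊕ Fin L₂ → MeasIdx L₁ L₂
  | Sum.inl a, Sum.inl b => Sum.inl (Sum.inl ⟨b + L₁ - 1 - a, by omega⟩)
  | Sum.inr a, Sum.inl b => Sum.inl (Sum.inr ⟨b + L₂ - 1 - a, by omega⟩)
  | Sum.inl a, Sum.inr b => Sum.inr (Sum.inl ⟨b + L₁ - 1 - a, by omega⟩)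
  | Sum.inr a, Sum.inr b => Sum.inr (Sum.inr ⟨b + L₂ - 1 - a, by omega⟩)

lemma measMatrix_apply (s : MeasIdx L₁ L₂) (q p : Fin L₁ ⊕ Fin L₂) :
    measMatrix L₁ L₂ s q p = if lagIndex q p = s then 1 else 0 := by
  rcases s with (k | k) | (k | k) <;> rcases q with a | a <;> rcases p with b | b <;>
    simp only [measMatrix, shiftMatrix, lagIndex, fromBlocks_apply₁₁, fromBlocks_apply₁₂,
      fromBlocks_apply₂₁, fromBlocks_apply₂₂, Matrix.zero_apply, of_apply, reduceCtorEq, if_false,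
      Sum.inl.injEq, Sum.inr.injEq, Fin.ext_iff] <;>
    (refine if_congr ?_ rfl rfl; omega)

lemma lagIndex_surjective (hL₁ : 0 < L₁) (hL₂ : 0 < L₂) (s : MeasIdx L₁ L₂) :
    ∃ qp : (Fin L₁ ⊕ Fin L₂) × (Fin L₁ ⊕ Fin L₂), lagIndex qp.1 qp.2 = s := by
  -- Every diagonal of an `m × n` matrix meets its first column or its first row.
  have key : ∀ (m n k : ℕ), 0 < m → 0 < n → k < m + n - 1 →
      ∃ (r : Fin m) (c : Fin n), (c : ℕ) + m - 1 - r = k := by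
    intro m n k hm hn hk
    by_cases h : k + 1 ≤ m
    · exact ⟨⟨m - 1 - k, by omega⟩, ⟨0, hn⟩, by simp only; omega⟩
    · exact ⟨⟨0, hm⟩, ⟨k + 1 - m, by omega⟩, by simp only; omega⟩
  rcases s with (⟨k, hk⟩ | ⟨k, hk⟩) | (⟨k, hk⟩ | ⟨k, hk⟩)
  · obtain ⟨r, c, h⟩ := key L₁ L₁ k hL₁ hL₁ hk
    exact ⟨(Sum.inl r, Sum.inl c), by simp [lagIndex, h]⟩
  · obtain ⟨r, c, h⟩ := key L₂ L₁ k hL₂ hL₁ (by omega)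
    exact ⟨(Sum.inr r, Sum.inl c), by simp [lagIndex, h]⟩
  · obtain ⟨r, c, h⟩ := key L₁ L₂ k hL₁ hL₂ (by omega)
    exact ⟨(Sum.inl r, Sum.inr c), by simp [lagIndex, h]⟩
  · obtain ⟨r, c, h⟩ := key L₂ L₂ k hL₂ hL₂ hk
    exact ⟨(Sum.inr r, Sum.inr c), by simp [lagIndex, h]⟩

lemma measMap_apply (X : Matrix (Fin L₁ ⊕ Fin L₂) (Fin L₁ ⊕ Fin L₂) ℂ) (s : MeasIdx L₁ L₂) :
    measMap X s = ∑ q, ∑ p, if lagIndex q p = s then X p q else 0 := by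
  simp [measMap, trace, mul_apply, measMatrix_apply]

lemma measMap_sub (X Y : Matrix (Fin L₁ ⊕ Fin L₂) (Fin L₁ ⊕ Fin L₂) ℂ) :
    measMap (X - Y) = measMap X - measMap Y := by
  ext s
  simp [measMap, Matrix.mul_sub]

/-- Cauchy–Schwarz over all `N²` index pairs, padded by zeros, costs `N²` in the square; each entry
of `X` enters exactly one measurement, so summing over measurements costs nothing more. -/
lemma norm_measMap_le (X : Matrix (Fin L₁ ⊕ Fin L₂) (Fin L₁ ⊕ Fin L₂) ℂ) :
    ‖measMap X‖ ≤ ((L₁ : ℝ) + L₂) * ‖X‖ := by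
  refine le_of_sq_le_sq ?_ (by positivity)
  have hN : (Finset.univ : Finset ((Fin L₁ ⊕ Fin L₂) × (Fin L₁ ⊕ Fin L₂))).card
      = (L₁ + L₂) ^ 2 := by
    simp [sq]
  have h1 : ∀ s : MeasIdx L₁ L₂, ‖measMap X s‖ ^ 2 ≤ ((L₁ : ℝ) + L₂) ^ 2 *
      ∑ qp : (Fin L₁ ⊕ Fin L₂) × (Fin L₁ ⊕ Fin L₂),
        if lagIndex qp.1 qp.2 = s then ‖X qp.2 qp.1‖ ^ 2 else 0 := by
    intro s
    rw [measMap_apply, ← Fintype.sum_prod_type']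
    calc _ ≤ (∑ qp : (Fin L₁ ⊕ Fin L₂) × (Fin L₁ ⊕ Fin L₂),
            ‖if lagIndex qp.1 qp.2 = s then X qp.2 qp.1 else 0‖) ^ 2 := by
          gcongr
          exact norm_sum_le _ _
      _ ≤ _ := sq_sum_le_card_mul_sum_sq
      _ = _ := by
          rw [hN]
          push_cast
          congr 1
          refine Finset.sum_congr rfl fun qp _ => ?_
          split_ifs <;> simp
  rw [EuclideanSpace.norm_sq_eq, mul_pow, frobenius_norm_sq]
  refine (Finset.sum_le_sum fun s _ => h1 s).trans_eq ?_
  rw [← Finset.mul_sum, Finset.sum_comm]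
  congr 1
  simp only [Finset.sum_ite_eq, Finset.mem_univ, if_true]
  rw [Fintype.sum_prod_type, Finset.sum_comm]

/-- Testing against a block Toeplitz matrix only sees the measurements. -/
lemma norm_trace_mul_le (hL₁ : 0 < L₁) (hL₂ : 0 < L₂)
    (W X : Matrix (Fin L₁ ⊕ Fin L₂) (Fin L₁ ⊕ Fin L₂) ℂ)
    (hW : ∀ q p q' p', lagIndex q p = lagIndex q' p' → W q p = W q' p') :
    ‖(W * X).trace‖ ≤ ‖W‖ * ‖measMap X‖ := by
  -- One representative entry of `W` per lag forms a vector whose inner product with the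
  -- measurements is the trace. Distinct lags pick distinct entries, so its norm is at most `‖W‖`.
  choose f hf using lagIndex_surjective (L₁ := L₁) (L₂ := L₂) hL₁ hL₂
  have hfinj : Function.Injective f := fun s t h => by rw [← hf s, h, hf]
  let ω : EuclideanSpace ℂ (MeasIdx L₁ L₂) := WithLp.toLp 2 fun s => star (W (f s).1 (f s).2)
  have htr : (W * X).trace = inner ℂ ω (measMap X) := by
    rw [PiLp.inner_apply]
    simp only [RCLike.inner_apply, measMap_apply, ω, RCLike.star_def, Complex.conj_conj,
      Finset.sum_mul]
    rw [Finset.sum_comm]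
    simp only [trace, diag_apply, mul_apply]
    refine Finset.sum_congr rfl fun q _ => ?_
    rw [Finset.sum_comm]
    refine Finset.sum_congr rfl fun p _ => ?_
    rw [Finset.sum_eq_single (lagIndex q p)]
    · rw [if_pos rfl, mul_comm, hW q p _ _ (hf _).symm]
    · intro s _ hs
      rw [if_neg hs.symm, zero_mul]
    · simp
  have hω : ‖ω‖ ≤ ‖W‖ := by
    refine le_of_sq_le_sq ?_ (norm_nonneg _)
    rw [EuclideanSpace.norm_sq_eq, frobenius_norm_sq, ← Fintype.sum_prod_type']
    simp only [ω, norm_star]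
    calc _ = ∑ qp ∈ Finset.univ.map ⟨f, hfinj⟩, ‖W qp.1 qp.2‖ ^ 2 :=
          (Finset.sum_map Finset.univ ⟨f, hfinj⟩ (fun qp => ‖W qp.1 qp.2‖ ^ 2)).symm
      _ ≤ _ := Finset.sum_le_univ_sum_of_nonneg fun _ => by positivity
  rw [htr]
  exact (norm_inner_le_norm _ _).trans (mul_le_mul_of_nonneg_right hω (norm_nonneg _))

/-- `hM` says that the shifts of `a` are not cut off, so row `i + c` exists. It suffices that one of
the two factors fits. -/
lemma sum_bandedToeplitz_mul {p p' q q' M : ℕ} (hM : p + q ≤ M + 1) (a : Fin p → ℝ)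
    (b : Fin p' → ℝ) (c : Fin q) (c' : Fin q') :
    ∑ r, bandedToeplitz M q a r c * bandedToeplitz M q' b r c'
      = ∑ i : Fin p, ∑ j : Fin p', if (i : ℕ) + c = j + c' then a i * b j else 0 := by
  simp only [bandedToeplitz_apply_eq_sum, Finset.sum_mul_sum]
  rw [Finset.sum_comm]
  refine Finset.sum_congr rfl fun i _ => ?_
  rw [Finset.sum_comm]
  refine Finset.sum_congr rfl fun j _ => ?_
  rw [Finset.sum_eq_single ⟨(i : ℕ) + c, by omega⟩]
  · simp [eq_comm]
  · intro r _ hr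
    rw [if_neg fun h => hr (Fin.ext h.symm), zero_mul]
  · simp

/-- Only the difference of the two column indices matters; the hypothesis states its equality
without truncated subtraction. -/
lemma sum_bandedToeplitz_mul_eq {p p' q q' M : ℕ} (hM : p + q ≤ M + 1) (a : Fin p → ℝ)
    (b : Fin p' → ℝ) {c d : Fin q} {c' d' : Fin q'} (h : (c : ℕ) + d' = d + c') :
    ∑ r, bandedToeplitz M q a r c * bandedToeplitz M q' b r c'
      = ∑ r, bandedToeplitz M q a r d * bandedToeplitz M q' b r d' := by
  rw [sum_bandedToeplitz_mul hM, sum_bandedToeplitz_mul hM]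
  refine Finset.sum_congr rfl fun i _ => Finset.sum_congr rfl fun j _ => if_congr ?_ rfl rfl
  omega

/-- The Gram matrix of a Sylvester matrix is block Toeplitz. -/
lemma sylvester_gram_toeplitz (a : Fin (L₂ + 1) → ℝ) (b : Fin (L₁ + 1) → ℝ)
    (q p q' p' : Fin L₁ ⊕ Fin L₂) (h : lagIndex q p = lagIndex q' p') :
    ((sylvester a b)ᴴ * sylvester a b) q p = ((sylvester a b)ᴴ * sylvester a b) q' p' := by
  rcases q with c | c <;> rcases p with d | d <;> rcases q' with c' | c' <;>
    rcases p' with d' | d' <;>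
    simp only [lagIndex, reduceCtorEq, Sum.inl.injEq, Sum.inr.injEq, Fin.mk.injEq] at h <;>
    simp only [mul_apply, conjTranspose_apply, star_trivial, sylvester, fromCols_apply_inl,
      fromCols_apply_inr] <;>
    exact sum_bandedToeplitz_mul_eq (by omega) _ _ (by omega)

lemma sum_bandedToeplitz_sq {p q M : ℕ} (hM : p + q ≤ M + 1) (a : Fin p → ℝ) (c : Fin q) :
    ∑ r, bandedToeplitz M q a r c * bandedToeplitz M q a r c = a ⬝ᵥ a := by
  rw [sum_bandedToeplitz_mul hM]
  refine Finset.sum_congr rfl fun i _ => ?_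
  rw [Finset.sum_eq_single i]
  · simp
  · intro j _ hj
    rw [if_neg fun h => hj (Fin.ext (by omega))]
  · simp

lemma addZero_dotProduct_self {L : ℕ} (u : Fin L → ℝ) : addZero u ⬝ᵥ addZero u = u ⬝ᵥ u := by
  simp [dotProduct, addZero, Fin.sum_univ_castSucc]

/-- The columns are `L₁` copies of `x₂` and `L₂` copies of `x₁`, up to shift, padding and sign. -/
lemma trace_sylvester_gram_le (x₁ : Fin L₁ → ℝ) (x₂ : Fin L₂ → ℝ)
    (hx : Sum.elim x₁ x₂ ⬝ᵥ Sum.elim x₁ x₂ = 1) :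
    ((sylvester (addZero x₂) (-addZero x₁))ᴴ * sylvester (addZero x₂) (-addZero x₁)).trace
      ≤ (L₁ : ℝ) + L₂ := by
  have h : x₁ ⬝ᵥ x₁ + x₂ ⬝ᵥ x₂ = 1 := by rw [← hx]; simp [dotProduct]
  have h1 : 0 ≤ x₁ ⬝ᵥ x₁ := Finset.sum_nonneg fun i _ => mul_self_nonneg _
  have h2 : 0 ≤ x₂ ⬝ᵥ x₂ := Finset.sum_nonneg fun i _ => mul_self_nonneg _
  have ht : ((sylvester (addZero x₂) (-addZero x₁))ᴴ *
      sylvester (addZero x₂) (-addZero x₁)).trace = L₁ * (x₂ ⬝ᵥ x₂) + L₂ * (x₁ ⬝ᵥ x₁) := by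
    simp only [trace, diag_apply, mul_apply, conjTranspose_apply, star_trivial, sylvester,
      Fintype.sum_sum_type, fromCols_apply_inl, fromCols_apply_inr]
    simp only [fun c => sum_bandedToeplitz_sq (show L₂ + 1 + L₁ ≤ L₁ + L₂ + 1 by omega) (addZero x₂) c,
      fun c => sum_bandedToeplitz_sq (show L₁ + 1 + L₂ ≤ L₁ + L₂ + 1 by omega) (-addZero x₁) c]
    simp [addZero_dotProduct_self]
  rw [ht]
  have hL₁ : (0 : ℝ) ≤ L₁ := L₁.cast_nonneg
  have hL₂ : (0 : ℝ) ≤ L₂ := L₂.cast_nonneg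
  nlinarith

lemma gramLambdaTwo_sylvester_le (hL₁ : 0 < L₁) (hL₂ : 0 < L₂) (x₁ : Fin L₁ → ℝ)
    (x₂ : Fin L₂ → ℝ) (hx : Sum.elim x₁ x₂ ⬝ᵥ Sum.elim x₁ x₂ = 1) :
    gramLambdaTwo (sylvester (addZero x₂) (-addZero x₁)) ≤ (L₁ : ℝ) + L₂ :=
  (gramLambdaTwo_le_trace _ (by simp only [Fintype.card_sum, Fintype.card_fin]; omega)).trans
    (trace_sylvester_gram_le x₁ x₂ hx)

lemma norm_sylvester_gram_le (x₁ : Fin L₁ → ℝ) (x₂ : Fin L₂ → ℝ)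
    (hx : Sum.elim x₁ x₂ ⬝ᵥ Sum.elim x₁ x₂ = 1) :
    ‖((sylvester (addZero x₂) (-addZero x₁))ᴴ *
      sylvester (addZero x₂) (-addZero x₁)).map Complex.ofReal‖ ≤ (L₁ : ℝ) + L₂ := by
  rw [frobenius_norm_map_eq _ _ fun a => Complex.norm_real a]
  exact (frobenius_norm_le_trace (posSemidef_conjTranspose_mul_self _)).trans
    (trace_sylvester_gram_le x₁ x₂ hx)

end Measurements

/-! ### Injectivity of the measurements on the tangent space -/

section Tangent

variable {L₁ L₂ : ℕ}

/-- `S` and `x` are real, so real and imaginary parts of `v` satisfy the gap estimate separately. -/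
lemma gramLambdaTwo_mul_le_complex {m n : Type*} [Fintype m] [Fintype n] [DecidableEq n]
    (S : Matrix m n ℝ) (hn : 2 ≤ Fintype.card n) (x : n → ℝ) (hx : x ⬝ᵥ x = 1)
    (hSx : S *ᵥ x = 0) (hpos : 0 < gramLambdaTwo S) (v : n → ℂ) :
    gramLambdaTwo S * (∑ i, ‖v i‖ ^ 2 - ‖∑ i, (x i : ℂ) * v i‖ ^ 2)
      ≤ ∑ r, ‖∑ i, (S r i : ℂ) * v i‖ ^ 2 := by
  have hre := gramLambdaTwo_mul_le S hn x hx hSx hpos fun i => (v i).re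
  have him := gramLambdaTwo_mul_le S hn x hx hSx hpos fun i => (v i).im
  have hnorm : ∀ z : ℂ, ‖z‖ ^ 2 = z.re * z.re + z.im * z.im := fun z => by
    rw [Complex.sq_norm, Complex.normSq_apply]
  have hR : ∀ w : n → ℝ, (∑ i, (w i : ℂ) * v i).re = w ⬝ᵥ fun i => (v i).re := fun w => by
    simp [dotProduct]
  have hI : ∀ w : n → ℝ, (∑ i, (w i : ℂ) * v i).im = w ⬝ᵥ fun i => (v i).im := fun w => by
    simp [dotProduct]
  have h1 : ∑ i, ‖v i‖ ^ 2
      = (fun i => (v i).re) ⬝ᵥ (fun i => (v i).re) + (fun i => (v i).im) ⬝ᵥ fun i => (v i).im := by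
    simp only [hnorm, Finset.sum_add_distrib, dotProduct]
  have h2 : ∑ r, ‖∑ i, (S r i : ℂ) * v i‖ ^ 2
      = (S *ᵥ fun i => (v i).re) ⬝ᵥ (S *ᵥ fun i => (v i).re)
        + (S *ᵥ fun i => (v i).im) ⬝ᵥ (S *ᵥ fun i => (v i).im) := by
    simp only [hnorm, hR, hI, Finset.sum_add_distrib]
    rfl
  rw [h1, h2, hnorm, hR, hI]
  nlinarith

lemma bandedToeplitz_addZero_apply {p M q : ℕ} (u : Fin p → ℝ) (r : Fin M) (c : Fin q) :
    bandedToeplitz M q (addZero u) r c = ∑ i : Fin p, if (i : ℕ) + c = r then u i else 0 := by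
  simp [bandedToeplitz_apply_eq_sum, addZero, Fin.sum_univ_castSucc]

lemma bandedToeplitz_neg {p M q : ℕ} (u : Fin p → ℝ) :
    bandedToeplitz M q (-u) = -bandedToeplitz M q u := by
  ext r c
  simp only [bandedToeplitz, of_apply, Matrix.neg_apply]
  split_ifs <;> simp

/-- The element `x h* + h x*` of the tangent space at a real rank-one matrix. -/
noncomputable def tangent {n : Type*} (x : n → ℝ) (h : n → ℂ) : Matrix n n ℂ :=
  Matrix.of fun p q => (x p : ℂ) * star (h q) + h p * (x q : ℂ)

/-- The reflected direction `(h₁, -conj h₂⁻)`. -/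
noncomputable def reflect (h : Fin L₁ ⊕ Fin L₂ → ℂ) : Fin L₁ ⊕ Fin L₂ → ℂ :=
  Sum.elim (fun i => h (Sum.inl i)) fun j => -star (h (Sum.inr j.rev))

/-- The off-diagonal block of the tangent element involves only `h₁` and `conj h₂`, so its diagonal
sums are `h₁ * x₂⁻ + x₁ * conj h₂⁻`. The sign in `reflect` cancels the one in `-addZero x₁`. -/
lemma sylvester_mul_reflect (x₁ : Fin L₁ → ℝ) (x₂ : Fin L₂ → ℝ) (h : Fin L₁ ⊕ Fin L₂ → ℂ)
    (r : Fin (L₁ + L₂)) :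
    ∑ i, ((sylvester (addZero (reversal x₂)) (-addZero x₁) r i : ℝ) : ℂ) * reflect h i
      = ∑ a : Fin L₂, ∑ b : Fin L₁, if (b : ℕ) + L₂ - 1 - a = r then
          tangent (Sum.elim x₁ x₂) h (Sum.inl b) (Sum.inr a) else 0 := by
  have h1 : ∀ b : Fin L₁, bandedToeplitz (L₁ + L₂) L₁ (addZero (reversal x₂)) r b
      = ∑ a : Fin L₂, if (b : ℕ) + L₂ - 1 - a = r then x₂ a else 0 := by
    intro b
    rw [bandedToeplitz_addZero_apply]
    refine Fintype.sum_equiv Fin.revPerm _ _ fun a => ?_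
    simp only [Fin.revPerm_apply, reversal, Fin.val_rev]
    exact if_congr (by omega) rfl rfl
  have h2 : ∑ j : Fin L₂, ((bandedToeplitz (L₁ + L₂) L₂ (addZero x₁) r j : ℝ) : ℂ)
        * star (h (Sum.inr j.rev))
      = ∑ a : Fin L₂, ∑ b : Fin L₁, if (b : ℕ) + L₂ - 1 - a = r then
          (x₁ b : ℂ) * star (h (Sum.inr a)) else 0 := by
    refine Fintype.sum_equiv Fin.revPerm _ _ fun a => ?_
    rw [bandedToeplitz_addZero_apply, Complex.ofReal_sum, Finset.sum_mul]
    refine Finset.sum_congr rfl fun b _ => ?_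
    simp only [Fin.revPerm_apply, Fin.val_rev]
    rw [if_congr (show (b : ℕ) + a = r ↔ (b : ℕ) + L₂ - 1 - (L₂ - (a + 1)) = r by omega) rfl rfl]
    split_ifs <;> simp
  have h3 : ∀ (a : Fin L₂) (b : Fin L₁), tangent (Sum.elim x₁ x₂) h (Sum.inl b) (Sum.inr a)
      = (x₁ b : ℂ) * star (h (Sum.inr a)) + (x₂ a : ℂ) * h (Sum.inl b) := by
    intro a b
    simp [tangent, mul_comm]
  have hsplit : ∀ (c : Prop) [Decidable c] (z w : ℂ),
      (if c then z + w else 0) = (if c then z else 0) + if c then w else 0 := by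
    intro c _ z w
    split_ifs <;> simp
  simp only [h3, hsplit, Finset.sum_add_distrib]
  rw [← h2, Finset.sum_comm, Fintype.sum_sum_type, add_comm]
  congr 1
  · refine Finset.sum_congr rfl fun j _ => ?_
    simp [sylvester, bandedToeplitz_neg, reflect]
  · refine Finset.sum_congr rfl fun b _ => ?_
    simp only [sylvester, fromCols_apply_inl, h1, reflect, Sum.elim_inl, Complex.ofReal_sum,
      Finset.sum_mul]
    refine Finset.sum_congr rfl fun a _ => ?_
    split_ifs <;> simp

lemma measMap_apply_cross (X : Matrix (Fin L₁ ⊕ Fin L₂) (Fin L₁ ⊕ Fin L₂) ℂ)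
    (k : Fin (L₁ + L₂ - 1)) :
    measMap X (Sum.inl (Sum.inr k)) = ∑ a : Fin L₂, ∑ b : Fin L₁,
      if (b : ℕ) + L₂ - 1 - a = k then X (Sum.inl b) (Sum.inr a) else 0 := by
  simp [measMap_apply, lagIndex, Fin.ext_iff]

lemma sum_sylvester_mul_reflect_le (hL₁ : 0 < L₁) (x₁ : Fin L₁ → ℝ) (x₂ : Fin L₂ → ℝ)
    (h : Fin L₁ ⊕ Fin L₂ → ℂ) :
    ∑ r, ‖∑ i, ((sylvester (addZero (reversal x₂)) (-addZero x₁) r i : ℝ) : ℂ) * reflect h i‖ ^ 2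
      ≤ ‖measMap (tangent (Sum.elim x₁ x₂) h)‖ ^ 2 := by
  simp only [sylvester_mul_reflect]
  set F : ℕ → ℂ := fun r => ∑ a : Fin L₂, ∑ b : Fin L₁, if (b : ℕ) + L₂ - 1 - a = r then
          tangent (Sum.elim x₁ x₂) h (Sum.inl b) (Sum.inr a) else 0 with hF
  -- The largest lag is `L₁ + L₂ - 2`, so the last Sylvester row corresponds to no measurement and
  -- contributes zero.
  have hlast : F (L₁ + L₂ - 1) = 0 :=
    Finset.sum_eq_zero fun a _ => Finset.sum_eq_zero fun b _ => if_neg (by omega)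
  have hsum : ∑ r : Fin (L₁ + L₂), ‖F r‖ ^ 2 = ∑ k : Fin (L₁ + L₂ - 1), ‖F k‖ ^ 2 := by
    rw [Fin.sum_univ_eq_sum_range (fun r => ‖F r‖ ^ 2),
      Fin.sum_univ_eq_sum_range (fun r => ‖F r‖ ^ 2)]
    obtain ⟨N, hN⟩ : ∃ N, L₁ + L₂ = N + 1 := ⟨L₁ + L₂ - 1, by omega⟩
    rw [hN, Nat.add_sub_cancel] at hlast
    rw [hN, Finset.sum_range_succ, Nat.add_sub_cancel, hlast]
    simp
  rw [hsum, EuclideanSpace.norm_sq_eq, Fintype.sum_sum_type, Fintype.sum_sum_type,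
    Fintype.sum_sum_type]
  simp only [measMap_apply_cross]
  have : ∀ a b c d : ℝ, 0 ≤ a → 0 ≤ c → 0 ≤ d → b ≤ a + b + (c + d) := by intros; linarith
  exact this _ _ _ _ (by positivity) (by positivity) (by positivity)

/-- The zero-lag autocorrelation of the first signal. -/
lemma measMap_tangent_inl (hL₁ : 0 < L₁) (x : Fin L₁ ⊕ Fin L₂ → ℝ) (h : Fin L₁ ⊕ Fin L₂ → ℂ) :
    measMap (tangent x h) (Sum.inl (Sum.inl ⟨L₁ - 1, by omega⟩))
      = ((2 * ∑ i, x (Sum.inl i) * (h (Sum.inl i)).re : ℝ) : ℂ) := by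
  simp only [measMap_apply, Fintype.sum_sum_type, lagIndex, Sum.inl.injEq, reduceCtorEq, if_false,
    Finset.sum_const_zero, add_zero, Fin.mk.injEq]
  rw [Finset.mul_sum, Complex.ofReal_sum]
  refine Finset.sum_congr rfl fun a _ => ?_
  rw [Finset.sum_eq_single a]
  · rw [if_pos (by omega)]
    apply Complex.ext <;> simp [tangent] <;> ring
  · intro b _ hb
    exact if_neg fun h' => hb (Fin.ext (by omega))
  · simp

lemma measMap_tangent_inr (hL₂ : 0 < L₂) (x : Fin L₁ ⊕ Fin L₂ → ℝ) (h : Fin L₁ ⊕ Fin L₂ → ℂ) :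
    measMap (tangent x h) (Sum.inr (Sum.inr ⟨L₂ - 1, by omega⟩))
      = ((2 * ∑ i, x (Sum.inr i) * (h (Sum.inr i)).re : ℝ) : ℂ) := by
  simp only [measMap_apply, Fintype.sum_sum_type, lagIndex, Sum.inr.injEq, reduceCtorEq, if_false,
    Finset.sum_const_zero, zero_add, Fin.mk.injEq]
  rw [Finset.mul_sum, Complex.ofReal_sum]
  refine Finset.sum_congr rfl fun a _ => ?_
  rw [Finset.sum_eq_single a]
  · rw [if_pos (by omega)]
    apply Complex.ext <;> simp [tangent] <;> ring
  · intro b _ hb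
    exact if_neg fun h' => hb (Fin.ext (by omega))
  · simp

/-- The direction `i x` generates the phase rotations of `x`, under which `x x*` is invariant. -/
lemma tangent_sub_mul_I {n : Type*} (x : n → ℝ) (h : n → ℂ) (b : ℝ) :
    tangent x (fun p => h p - b * x p * Complex.I) = tangent x h := by
  ext p q
  simp only [tangent, of_apply, star_sub, star_mul', RCLike.star_def, Complex.conj_ofReal,
    Complex.conj_I]
  ring

lemma norm_tangent_le {n : Type*} [Fintype n] (x : n → ℝ) (hx : x ⬝ᵥ x = 1) (h : n → ℂ) :
    ‖tangent x h‖ ≤ 2 * √(∑ p, ‖h p‖ ^ 2) := by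
  have hx' : ∑ p, ‖(x p : ℂ)‖ ^ 2 = 1 := by
    rw [← hx]
    simp [dotProduct, sq]
  have key : ∀ u v : n → ℂ, ‖vecMulVec u v‖ = √((∑ p, ‖u p‖ ^ 2) * ∑ p, ‖v p‖ ^ 2) := by
    intro u v
    rw [eq_comm, Real.sqrt_eq_iff_mul_self_eq (by positivity) (norm_nonneg _), ← sq,
      frobenius_norm_sq, Finset.sum_mul_sum]
    simp [vecMulVec_apply, mul_pow]
  have hdec : tangent x h
      = vecMulVec (fun p => (x p : ℂ)) (star h) + vecMulVec h fun p => (x p : ℂ) := by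
    ext p q
    simp [tangent, vecMulVec_apply]
  rw [hdec, two_mul]
  refine (norm_add_le _ _).trans (add_le_add ?_ ?_)
  · rw [key, hx', one_mul]
    simp
  · rw [key, hx', mul_one]

/-- Quantitative injectivity of the measurements on the tangent space at the lifted signal. -/
lemma norm_tangent_le_measMap (hL₁ : 0 < L₁) (hL₂ : 0 < L₂) (x₁ : Fin L₁ → ℝ)
    (x₂ : Fin L₂ → ℝ) (hx : Sum.elim x₁ x₂ ⬝ᵥ Sum.elim x₁ x₂ = 1)
    (hpos : 0 < gramLambdaTwo (sylvester (addZero (reversal x₂)) (-addZero x₁)))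
    (h : Fin L₁ ⊕ Fin L₂ → ℂ) :
    ‖tangent (Sum.elim x₁ x₂) h‖ ≤ 2 * ((L₁ : ℝ) + L₂)
      / √(gramLambdaTwo (sylvester (addZero (reversal x₂)) (-addZero x₁)))
      * ‖measMap (tangent (Sum.elim x₁ x₂) h)‖ := by
  have hcard : 2 ≤ Fintype.card (Fin L₁ ⊕ Fin L₂) := by
    simp only [Fintype.card_sum, Fintype.card_fin]; omega
  have hx' := (dotProduct_elim_reversal x₁ x₂).trans hx
  have hgap := gramLambdaTwo_mul_le_complex _ hcard _ hx' (sylvester_mulVec_self _ _) hpos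
    (reflect h)
  have hle := gramLambdaTwo_sylvester_le hL₁ hL₂ _ _ hx'
  have hcross := sum_sylvester_mul_reflect_le hL₁ x₁ x₂ h
  set lam := gramLambdaTwo (sylvester (addZero (reversal x₂)) (-addZero x₁))
  set g := measMap (tangent (Sum.elim x₁ x₂) h) with hg
  -- `a` and `b` are the real and imaginary parts of the coefficient of `reflect h` along the kernel
  -- vector `(x₁, x₂⁻)`, which the spectral gap does not see.
  set a : ℝ := ∑ i, x₁ i * (h (Sum.inl i)).re - ∑ i, x₂ i * (h (Sum.inr i)).re with ha
  set b : ℝ := ∑ i, Sum.elim x₁ x₂ i * (h i).im with hb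
  have hnorm : ∀ z : ℂ, ‖z‖ ^ 2 = z.re * z.re + z.im * z.im := fun z => by
    rw [Complex.sq_norm, Complex.normSq_apply]
  have hrefl : ∑ i, ‖reflect h i‖ ^ 2 = ∑ i, ‖h i‖ ^ 2 := by
    simp only [Fintype.sum_sum_type, reflect, Sum.elim_inl, Sum.elim_inr, norm_neg, norm_star]
    congr 1
    exact Fintype.sum_equiv Fin.revPerm _ _ fun _ => rfl
  have hinner : ∑ i, ((Sum.elim x₁ (reversal x₂) i : ℝ) : ℂ) * reflect h i = a + b * Complex.I := by
    have h2 : ∑ j : Fin L₂, (reversal x₂ j : ℂ) * -star (h (Sum.inr j.rev))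
        = ∑ j : Fin L₂, (x₂ j : ℂ) * -star (h (Sum.inr j)) :=
      Fintype.sum_equiv Fin.revPerm _ _ fun _ => rfl
    rw [Fintype.sum_sum_type]
    simp only [reflect, Sum.elim_inl, Sum.elim_inr, h2]
    apply Complex.ext
    · simp [ha, sub_eq_add_neg]
    · simp [hb, Fintype.sum_sum_type]
  have hinner' : ‖∑ i, ((Sum.elim x₁ (reversal x₂) i : ℝ) : ℂ) * reflect h i‖ ^ 2
      = a ^ 2 + b ^ 2 := by
    rw [hinner, hnorm]
    simp [sq]
  -- Subtracting the phase direction `i b x` from `h` removes exactly `b²` from its squared norm.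
  have hshift : ∑ p, ‖h p - b * Sum.elim x₁ x₂ p * Complex.I‖ ^ 2 = ∑ p, ‖h p‖ ^ 2 - b ^ 2 := by
    have : ∀ p, ‖h p - b * Sum.elim x₁ x₂ p * Complex.I‖ ^ 2 = ‖h p‖ ^ 2
        - 2 * b * (Sum.elim x₁ x₂ p * (h p).im) + b ^ 2 * (Sum.elim x₁ x₂ p * Sum.elim x₁ x₂ p) := by
      intro p
      rw [hnorm, hnorm]
      simp
      ring
    simp only [this, Finset.sum_add_distrib, Finset.sum_sub_distrib, ← Finset.mul_sum]
    rw [← hb, show ∑ p, Sum.elim x₁ x₂ p * Sum.elim x₁ x₂ p = 1 from hx]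
    ring
  -- `a` is half the difference of the two zero-lag autocorrelations, each at most `‖g‖` in modulus.
  have ha2 : a ^ 2 ≤ ‖g‖ ^ 2 := by
    have h1 := PiLp.norm_apply_le g (Sum.inl (Sum.inl ⟨L₁ - 1, by omega⟩))
    have h2 := PiLp.norm_apply_le g (Sum.inr (Sum.inr ⟨L₂ - 1, by omega⟩))
    rw [hg, measMap_tangent_inl hL₁, ← hg, Complex.norm_real, Real.norm_eq_abs, abs_le] at h1
    rw [hg, measMap_tangent_inr hL₂, ← hg, Complex.norm_real, Real.norm_eq_abs, abs_le] at h2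
    simp only [Sum.elim_inl, Sum.elim_inr] at h1 h2
    exact sq_le_sq' (by linarith) (by linarith)
  have hfinal : ∑ p, ‖h p - b * Sum.elim x₁ x₂ p * Complex.I‖ ^ 2
      ≤ (((L₁ : ℝ) + L₂) / √lam * ‖g‖) ^ 2 := by
    rw [hrefl, hinner'] at hgap
    rw [hshift, mul_pow, div_pow, Real.sq_sqrt hpos.le, div_mul_eq_mul_div, le_div_iff₀ hpos]
    have hN : ((2 : ℕ) : ℝ) ≤ ((L₁ + L₂ : ℕ) : ℝ) := Nat.cast_le.mpr (by omega)
    push_cast at hN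
    -- From `lam ≤ N` and `N ≥ 2` follows `lam + 1 ≤ N + 1 ≤ N²`.
    have hlam : lam + 1 ≤ ((L₁ : ℝ) + L₂) ^ 2 := by nlinarith
    calc (∑ p, ‖h p‖ ^ 2 - b ^ 2) * lam
        = lam * (∑ p, ‖h p‖ ^ 2 - (a ^ 2 + b ^ 2)) + lam * a ^ 2 := by ring
      _ ≤ ‖g‖ ^ 2 + lam * ‖g‖ ^ 2 :=
          add_le_add (hgap.trans hcross) (mul_le_mul_of_nonneg_left ha2 hpos.le)
      _ = (lam + 1) * ‖g‖ ^ 2 := by ring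
      _ ≤ _ := mul_le_mul_of_nonneg_right hlam (sq_nonneg _)
  rw [← tangent_sub_mul_I _ h b]
  refine (norm_tangent_le _ hx _).trans ?_
  rw [mul_div_assoc, mul_assoc]
  refine mul_le_mul_of_nonneg_left ?_ zero_le_two
  exact (Real.sqrt_le_sqrt hfinal).trans_eq (Real.sqrt_sq (by positivity))

end Tangent

/-! ### Dual certificate bound and assembly of the stability estimate -/

section Stability

variable {L₁ L₂ : ℕ}

lemma mulVec_map_ofReal {m n : Type*} [Fintype n] (A : Matrix m n ℝ) (x : n → ℝ) :
    A.map Complex.ofReal *ᵥ (fun p => (x p : ℂ)) = fun p => ((A *ᵥ x) p : ℂ) := by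
  funext p
  simp [mulVec, dotProduct]

/-- The complex rank-one matrix `x xᵀ` of a real vector. -/
noncomputable def rankOne {n : Type*} (x : n → ℝ) : Matrix n n ℂ :=
  vecMulVec (fun p => (x p : ℂ)) fun p => (x p : ℂ)

lemma isHermitian_rankOne {n : Type*} (x : n → ℝ) : (rankOne x).IsHermitian := by
  ext p q
  simp [rankOne, vecMulVec_apply, mul_comm]

lemma rankOne_mul_self {n : Type*} [Fintype n] (x : n → ℝ) (hx : x ⬝ᵥ x = 1) :
    rankOne x * rankOne x = rankOne x := by
  have : (fun p => (x p : ℂ)) ⬝ᵥ (fun p => (x p : ℂ)) = 1 := by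
    rw [← Complex.ofReal_one, ← hx]
    simp [dotProduct]
  rw [rankOne, vecMulVec_mul_vecMulVec, this, one_smul]

/-- The compression of a Hermitian matrix to the complement of `x` differs from it by an element of
the tangent space. -/
lemma exists_sub_compression_eq_tangent {n : Type*} [Fintype n] [DecidableEq n] (x : n → ℝ)
    (A : Matrix n n ℂ) (hA : A.IsHermitian) :
    ∃ h : n → ℂ, A - (1 - rankOne x) * A *
      (1 - rankOne x) = tangent x h := by
  set y : n → ℂ := fun p => (x p : ℂ) with hy
  have hystar : star y = y := by
    funext p
    simp [hy]
  have hvec : star (A *ᵥ y) = y ᵥ* A := by rw [star_mulVec, hA.eq, hystar]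
  have hc : star (y ⬝ᵥ (A *ᵥ y)) = y ⬝ᵥ (A *ᵥ y) := by
    rw [← star_dotProduct_star, hvec, hystar, ← dotProduct_mulVec]
  -- With `h = A y` the component of `A` along `y yᵀ` would be counted twice; half of it is removed
  -- from `h`, its coefficient being real by `hc`.
  refine ⟨fun p => (A *ᵥ y) p - 1 / 2 * (y ⬝ᵥ (A *ᵥ y)) * y p, ?_⟩
  have hexp : A - (1 - vecMulVec y y) * A * (1 - vecMulVec y y)
      = vecMulVec y (y ᵥ* A) + vecMulVec (A *ᵥ y) y - vecMulVec y ((y ⬝ᵥ (A *ᵥ y)) • y) := by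
    rw [Matrix.sub_mul, Matrix.mul_sub, Matrix.one_mul, Matrix.mul_one, vecMulVec_mul,
      mul_vecMulVec, sub_mulVec, vecMulVec_mulVec, ← dotProduct_mulVec]
    ext p q
    simp only [Matrix.sub_apply, Matrix.add_apply, vecMulVec_apply, Pi.sub_apply, Pi.smul_apply,
      MulOpposite.smul_eq_mul_unop, MulOpposite.unop_op, smul_eq_mul]
    ring
  rw [rankOne, hexp, ← hvec]
  ext p q
  have hyq : star (y q) = y q := congrFun hystar q
  simp only [Matrix.sub_apply, Matrix.add_apply, vecMulVec_apply, tangent, of_apply, Pi.smul_apply,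
    Pi.star_apply, smul_eq_mul, star_sub, star_mul', hc, hyq]
  rw [show star (1 / 2 : ℂ) = 1 / 2 by simp]
  ring

/-- The part of a feasible point off the tangent space is controlled by the measurements. -/
lemma norm_compression_le (hL₁ : 0 < L₁) (hL₂ : 0 < L₂) (x₁ : Fin L₁ → ℝ)
    (x₂ : Fin L₂ → ℝ) (hx : Sum.elim x₁ x₂ ⬝ᵥ Sum.elim x₁ x₂ = 1)
    (hpos : 0 < gramLambdaTwo (sylvester (addZero x₂) (-addZero x₁))) (c : ℂ)
    (X : Matrix (Fin L₁ ⊕ Fin L₂) (Fin L₁ ⊕ Fin L₂) ℂ) (hX : X.PosSemidef) :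
    ‖(1 - rankOne (Sum.elim x₁ x₂)) * X *
        (1 - rankOne (Sum.elim x₁ x₂))‖
      ≤ ((L₁ : ℝ) + L₂) / gramLambdaTwo (sylvester (addZero x₂) (-addZero x₁)) *
        ‖measMap (X - c • rankOne (Sum.elim x₁ x₂))‖ := by
  have hcard : 2 ≤ Fintype.card (Fin L₁ ⊕ Fin L₂) := by
    simp only [Fintype.card_sum, Fintype.card_fin]; omega
  set S := sylvester (addZero x₂) (-addZero x₁) with hS
  set x := Sum.elim x₁ x₂
  set lam := gramLambdaTwo S
  set Q := rankOne x with hQ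
  set W := (Sᴴ * S).map Complex.ofReal with hW
  have hQQ : Q * Q = Q := rankOne_mul_self x hx
  have hQh : (1 - Q)ᴴ = 1 - Q := isHermitian_one.sub (isHermitian_rankOne x)
  have hPP : (1 - Q) * (1 - Q) = 1 - Q := by
    rw [Matrix.mul_sub, Matrix.sub_mul 1 Q Q, hQQ]
    simp
  have hM : ((1 - Q) * X * (1 - Q)).PosSemidef := by
    have := hX.mul_mul_conjTranspose_same (1 - Q)
    rwa [hQh] at this
  -- Because `W` annihilates `Q`, any multiple `c • Q` can be subtracted from `X` without changing
  -- `tr (W X)`.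
  have hWQ : W * Q = 0 := by
    rw [hQ, rankOne, mul_vecMulVec, hW, mulVec_map_ofReal, ← mulVec_mulVec, hS,
      sylvester_mulVec_self, mulVec_zero]
    ext p q
    simp [vecMulVec_apply]
  have hgap : (W - (lam : ℂ) • (1 - Q)).PosSemidef := by
    have := posSemidef_map_ofReal (posSemidef_gram_sub S hcard x hx (sylvester_mulVec_self _ _) hpos)
    convert this using 1
    ext p q
    by_cases hpq : p = q <;>
      simp [hW, hQ, rankOne, vecMulVec_apply, lam, hpq]
  have htr := trace_mul_re_nonneg hgap hX
  have htrM : ((1 - Q) * X * (1 - Q)).trace = ((1 - Q) * X).trace := by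
    rw [trace_mul_comm, ← Matrix.mul_assoc, hPP]
  have hWX : (W * X).trace = (W * (X - c • Q)).trace := by
    rw [Matrix.mul_sub, Matrix.mul_smul, hWQ, smul_zero, sub_zero]
  rw [Matrix.sub_mul, trace_sub, smul_mul, trace_smul, ← htrM, hWX, smul_eq_mul, Complex.sub_re,
    Complex.re_ofReal_mul, sub_nonneg] at htr
  have hbound : (W * (X - c • Q)).trace.re ≤ ((L₁ : ℝ) + L₂) * ‖measMap (X - c • Q)‖ := by
    refine (Complex.re_le_norm _).trans ((norm_trace_mul_le hL₁ hL₂ W _ ?_).trans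
      (mul_le_mul_of_nonneg_right (norm_sylvester_gram_le x₁ x₂ hx) (norm_nonneg _)))
    intro q p q' p' h
    rw [hW, map_apply, map_apply, sylvester_gram_toeplitz _ _ q p q' p' h]
  refine (frobenius_norm_le_trace hM).trans ?_
  rw [div_mul_eq_mul_div, le_div_iff₀ hpos, mul_comm]
  exact htr.trans hbound

/-- The compression `M` is small by the certificate. The tangent remainder has measurements `𝒜(X - c
Q) - 𝒜(M)`, hence at most `δ + N ‖M‖` in norm, and injectivity on the tangent space bounds it. -/
lemma norm_sub_le_of_measMap_le (hL₁ : 0 < L₁) (hL₂ : 0 < L₂) (x₁ : Fin L₁ → ℝ)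
    (x₂ : Fin L₂ → ℝ) (hx : Sum.elim x₁ x₂ ⬝ᵥ Sum.elim x₁ x₂ = 1) {lam mu : ℝ}
    (hlam : gramLambdaTwo (sylvester (addZero x₂) (-addZero x₁)) = lam)
    (hmu : gramLambdaTwo (sylvester (addZero (reversal x₂)) (-addZero x₁)) = mu)
    (hlam0 : 0 < lam) (hmu0 : 0 < mu) (c : ℝ)
    (X : Matrix (Fin L₁ ⊕ Fin L₂) (Fin L₁ ⊕ Fin L₂) ℂ) (hX : X.PosSemidef) {δ : ℝ}
    (hδ : ‖measMap (X - (c : ℂ) • rankOne (Sum.elim x₁ x₂))‖ ≤ δ) :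
    ‖X - (c : ℂ) • rankOne (Sum.elim x₁ x₂)‖ ≤
      ((L₁ : ℝ) + L₂) / lam * δ + 2 * ((L₁ : ℝ) + L₂) / √mu *
        (δ + ((L₁ : ℝ) + L₂) * (((L₁ : ℝ) + L₂) / lam * δ)) := by
  have hcomp := norm_compression_le hL₁ hL₂ x₁ x₂ hx (hlam ▸ hlam0) (c : ℂ) X hX
  rw [hlam] at hcomp
  have htan := norm_tangent_le_measMap hL₁ hL₂ x₁ x₂ hx (hmu ▸ hmu0)
  rw [hmu] at htan
  set x := Sum.elim x₁ x₂
  set Q := rankOne x with hQ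
  have hQQ : Q * Q = Q := rankOne_mul_self x hx
  have hQh : Q.IsHermitian := isHermitian_rankOne x
  have hH : (X - (c : ℂ) • Q).IsHermitian := by
    refine hX.1.sub ?_
    rw [IsHermitian, conjTranspose_smul, hQh.eq]
    simp
  obtain ⟨h, hh⟩ := exists_sub_compression_eq_tangent x _ hH
  rw [← hQ] at hh
  -- `1 - Q` kills `Q`, so compressing the indefinite matrix `X - c Q` gives the positive
  -- semidefinite compression of `X`.
  have hPH : (1 - Q) * (X - (c : ℂ) • Q) * (1 - Q) = (1 - Q) * X * (1 - Q) := by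
    have : (1 - Q) * ((c : ℂ) • Q) = 0 := by
      rw [Matrix.mul_smul, Matrix.sub_mul, hQQ, Matrix.one_mul, sub_self, smul_zero]
    rw [Matrix.mul_sub (1 - Q), this, sub_zero]
  rw [hPH] at hh
  set M := (1 - Q) * X * (1 - Q)
  have hN : (0 : ℝ) ≤ (L₁ : ℝ) + L₂ := by positivity
  have hMle : ‖M‖ ≤ ((L₁ : ℝ) + L₂) / lam * δ :=
    hcomp.trans (mul_le_mul_of_nonneg_left hδ (by positivity))
  have hT : ‖tangent x h‖ ≤ 2 * ((L₁ : ℝ) + L₂) / √mu *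
      (δ + ((L₁ : ℝ) + L₂) * (((L₁ : ℝ) + L₂) / lam * δ)) := by
    refine (htan h).trans (mul_le_mul_of_nonneg_left ?_ (by positivity))
    rw [← hh, measMap_sub]
    exact (norm_sub_le _ _).trans (add_le_add hδ ((norm_measMap_le M).trans
      (mul_le_mul_of_nonneg_left hMle hN)))
  calc ‖X - (c : ℂ) • Q‖ = ‖M + tangent x h‖ := by rw [← hh]; congr 1; abel
    _ ≤ ‖M‖ + ‖tangent x h‖ := norm_add_le _ _
    _ ≤ _ := add_le_add hMle hT

lemma liftedSignal_eq_smul (hL₁ : 0 < L₁) (x₁ : Fin L₁ → ℝ) (x₂ : Fin L₂ → ℝ)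
    (hx₁ : x₁ ⟨0, hL₁⟩ ≠ 0) :
    liftedSignal x₁ x₂ = ((‖stack x₁ x₂‖ ^ 2 : ℝ) : ℂ) • rankOne
      (Sum.elim (‖stack x₁ x₂‖⁻¹ • x₁) (‖stack x₁ x₂‖⁻¹ • x₂)) := by
  have hne : (‖stack x₁ x₂‖ : ℂ) ≠ 0 :=
    Complex.ofReal_ne_zero.mpr (norm_stack_pos hL₁ x₁ x₂ hx₁).ne'
  have h : ∀ p, ((Sum.elim (‖stack x₁ x₂‖⁻¹ • x₁) (‖stack x₁ x₂‖⁻¹ • x₂) p : ℝ) : ℂ)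
      = (‖stack x₁ x₂‖ : ℂ)⁻¹ * (stack x₁ x₂ p : ℂ) := by
    rintro (i | i) <;> simp [stack]
  ext p q
  simp only [liftedSignal, rankOne, of_apply, Matrix.smul_apply, vecMulVec_apply, h, RCLike.star_def,
    Complex.conj_ofReal, smul_eq_mul]
  push_cast
  field_simp

lemma liftedSignal_mem_realPsdCone (x₁ : Fin L₁ → ℝ) (x₂ : Fin L₂ → ℝ) :
    liftedSignal x₁ x₂ ∈ realPsdCone L₁ L₂ := by
  refine ⟨?_, fun p q => by simp [liftedSignal]⟩
  exact posSemidef_vecMulVec_self_star fun p => ((stack x₁ x₂ p : ℝ) : ℂ)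

/-- The true signal is feasible with residual `‖n‖`, so the minimizer's residual is no larger; the
triangle inequality doubles it. -/
lemma norm_measMap_sub_le_of_isSDPSolution
    {K : Set (Matrix (Fin L₁ ⊕ Fin L₂) (Fin L₁ ⊕ Fin L₂) ℂ)}
    {X₀ X : Matrix (Fin L₁ ⊕ Fin L₂) (Fin L₁ ⊕ Fin L₂) ℂ} (hX₀ : X₀ ∈ K)
    {n : EuclideanSpace ℂ (MeasIdx L₁ L₂)} (h : IsSDPSolution K (measMap X₀ + n) X) :
    ‖measMap (X - X₀)‖ ≤ 2 * ‖n‖ := by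
  have h1 : ‖measMap X - (measMap X₀ + n)‖ ≤ ‖measMap X₀ - (measMap X₀ + n)‖ := h.2 hX₀
  rw [sub_add_cancel_left, norm_neg] at h1
  have h2 : measMap (X - X₀) = (measMap X - (measMap X₀ + n)) + n := by
    rw [measMap_sub]
    abel
  rw [h2, two_mul]
  exact (norm_add_le _ _).trans (add_le_add h1 le_rfl)

/-- The left side equals `2 N ν (2 N² / (lam √mu) + 1 / lam + 2 / √mu)`, which the stated constant
dominates term by term. -/
lemma stability_constant_le {N lam mu ν : ℝ} (hN : 0 ≤ N) (hlam : 0 < lam) (hmu : 0 < mu)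
    (hν : 0 ≤ ν) :
    N / lam * (2 * ν) + 2 * N / √mu * (2 * ν + N * (N / lam * (2 * ν))) ≤
      2 * N * (23 * N ^ 2 / (lam * √mu) + 1 / lam + 4 * √2 / √mu) * ν := by
  have hs : 0 < √mu := Real.sqrt_pos.mpr hmu
  have h2 : 1 ≤ √2 := Real.one_le_sqrt.mpr one_le_two
  have hdiff : 2 * N * (23 * N ^ 2 / (lam * √mu) + 1 / lam + 4 * √2 / √mu) * ν
      - (N / lam * (2 * ν) + 2 * N / √mu * (2 * ν + N * (N / lam * (2 * ν))))
      = 42 * (N ^ 3 * ν / (lam * √mu)) + (8 * √2 - 4) * (N * ν / √mu) := by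
    field_simp
    ring
  have : 0 ≤ 42 * (N ^ 3 * ν / (lam * √mu)) + (8 * √2 - 4) * (N * ν / √mu) := by
    have : 0 ≤ 8 * √2 - 4 := by linarith
    positivity
  linarith

end Stability

end BlindDeconv

theorem mainTheorem1 (L₁ L₂ : ℕ) (hL₁ : 0 < L₁) (hL₂ : 0 < L₂)
    (x₁ : Fin L₁ → ℝ) (x₂ : Fin L₂ → ℝ)
    (hx₁ : x₁ ⟨0, hL₁⟩ ≠ 0)
    (hx₂ : x₂ ⟨0, hL₂⟩ ≠ 0)
    (hx₂' : x₂ ⟨L₂ - 1, Nat.sub_lt hL₂ Nat.one_pos⟩ ≠ 0) :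
    (0 < BlindDeconv.lambdaTwoW x₁ x₂ ↔
      IsCoprime (BlindDeconv.zPoly x₁) (BlindDeconv.zPoly x₂)) ∧
    (0 < BlindDeconv.lambdaTwoWminus x₁ x₂ ↔
      IsCoprime (BlindDeconv.zPoly x₁) (BlindDeconv.zPoly (BlindDeconv.reversal x₂))) ∧
    (0 < BlindDeconv.lambdaTwoW x₁ x₂ → 0 < BlindDeconv.lambdaTwoWminus x₁ x₂ →
      ∀ n : EuclideanSpace ℂ (BlindDeconv.MeasIdx L₁ L₂),
      ∀ K : Set (Matrix (Fin L₁ ⊕ Fin L₂) (Fin L₁ ⊕ Fin L₂) ℂ),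
        K = BlindDeconv.psdCone L₁ L₂ ∨ K = BlindDeconv.realPsdCone L₁ L₂ →
      ∀ Xhat : Matrix (Fin L₁ ⊕ Fin L₂) (Fin L₁ ⊕ Fin L₂) ℂ,
        BlindDeconv.IsSDPSolution K
          (BlindDeconv.measMap (BlindDeconv.liftedSignal x₁ x₂) + n) Xhat →
        ‖Xhat - BlindDeconv.liftedSignal x₁ x₂‖ ≤ BlindDeconv.stabilityConst x₁ x₂ * ‖n‖) := by
  refine ⟨BlindDeconv.lambdaTwoW_pos_iff hL₁ hL₂ x₁ x₂ hx₁,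
    BlindDeconv.lambdaTwoWminus_pos_iff hL₁ hL₂ x₁ x₂ hx₁, fun hW hWm n K hK Xhat hsol => ?_⟩
  have hmem := BlindDeconv.liftedSignal_mem_realPsdCone x₁ x₂
  -- `x x*` is real, hence feasible for either cone, and the remaining estimates use only that
  -- `Xhat` is positive semidefinite.
  have hK' : BlindDeconv.liftedSignal x₁ x₂ ∈ K ∧ Xhat.PosSemidef := by
    rcases hK with rfl | rfl
    · exact ⟨hmem.1, hsol.1⟩
    · exact ⟨hmem, hsol.1.1⟩
  have hδ := BlindDeconv.norm_measMap_sub_le_of_isSDPSolution hK'.1 hsol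
  rw [BlindDeconv.liftedSignal_eq_smul hL₁ x₁ x₂ hx₁] at hδ ⊢
  refine (BlindDeconv.norm_sub_le_of_measMap_le hL₁ hL₂ _ _
    (BlindDeconv.dotProduct_normalized hL₁ x₁ x₂ hx₁) rfl rfl hW hWm _ Xhat hK'.2 hδ).trans ?_
  exact BlindDeconv.stability_constant_le (by positivity) hW hWm (norm_nonneg n)
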